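/- **Setting.** Let $\mathcal A$ be the CAR algebra over $\mathbb Z$, i.e. the unital $C^*$-algebra generated by elements $a_i$ ($i\in\mathbb Z$) with $\{a_i,a_j\}=0$ and $\{a_i^*,a_j\}=\delta_{i,j}1$ (realized on the fermionic Fock space over $\mathbb Z$). Let $\gamma$ be the automorphism of $\mathcal A$ with $\gamma(a_i)=-a_i$. For finite $I\subset\mathbb Z$ let $\mathcal A(I)$ be the $*$-algebra generated by $\{a_i: i\in I\}$, and let $\mathcal A_\circ=\bigcup_I\mathcal A(I)$ be the local algebra. Put $q_i=a_{2i+1}a_{2i}^*a_{2i-1}$. For $A\in\mathcal A_\circ$ define $$\delta(A)=\sum_{i\in\mathbb Z}\bigl(q_iA-\gamma(A)q_i\bigr),\qquad \delta^*(A)=\sum_{i\in\mathbb Z}\bigl(q_i^*A-\gamma(A)q_i^*\bigr),\qquad d=\delta^*\delta+\delta\,\delta^*$$ (for $A\in\mathcal A_\circ$ only finitely many terms are nonzero). Formally, $d(A)=[H,A]$ with $H=QQ^*+Q^*Q$ and $Q=\sum_i q_i$. The *infinite-volume Heisenberg time evolution of the Nicolai model* is the strongly continuous one-parameter group $\alpha_t$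 ($t\in\mathbb R$) of $*$-automorphisms of $\mathcal A$ whose generator $A\mapsto\frac{d}{dt}\alpha_t(A)|_{t=0}$ (defined wherever the norm derivative exists) is the closure of $A\mapsto i\,d(A)$, $A\in\mathcal A_\circ$. For integers $k<l$ let $\hat\Xi_{k,l}$ be the set of all $f:\{2k,2k+1,\dots,2l\}\to\{-1,+1\}$ such that $f(2k)=f(2k+1)$, $f(2l-1)=f(2l)$, and such that for no $i$ with $\{2i-1,2i,2i+1\}\subset[2k,2l]$ the triple $(f(2i-1),f(2i),f(2i+1))$ equals $(-1,+1,-1)$ or $(+1,-1,+1)$. For such $f$ put $$\mathscr Q(f)=\zeta_{2k}(f(2k))\,\zeta_{2k+1}(f(2k+1))\cdots\zeta_{2l}(f(2l)),\qquad \zeta_i(-1)=a_i,\quad \zeta_i(+1)=a_i^*.$$ Let $\mathcal C$ be the $*$-algebra generated by all $\mathscr Q(f)$, $f\in\hat\Xi_{k,l}$, $k<l$. **Theorem.** The time evolution $\alpha_t$ of the Nicolai model exists, and for every $B\in\mathcal C$ $$\alpha_t(B)=B\quad\text{for all } t\in\mathbb R.$$ In particular, for all integers $k<l$ and every $f\in\hat\Xi_{k,l}$,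 $\alpha_t(\mathscr Q(f))=\mathscr Q(f)$ and $\alpha_t(\mathscr Q(f)^*)=\mathscr Q(f)^*$ for all $t\in\mathbb R$. -/

import Mathlib

open scoped ENNReal

namespace Nicolai

noncomputable section

/-! ### The Fock space over the lattice `ℤ` and its fermion operators -/

/-- The antisymmetric Fock space over `ℤ`: square-summable functions on the finite subsets of `ℤ`.
The basis vector attached to `S = {i₁ < ⋯ < iₙ}` is `a*_{i₁} ⋯ a*_{iₙ} Ω`. -/
abbrev Fock : Type := lp (fun _ : Finset ℤ => ℂ) 2

/-- Bounded operators on the Fock space. -/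
abbrev FockOp : Type := Fock →L[ℂ] Fock

theorem summable_weighted (e : Finset ℤ → Finset ℤ) (c : Finset ℤ → ℂ)
    (hc : ∀ S, ‖c S‖ ≤ 1) (he : Set.InjOn e {S | c S ≠ 0}) (ψ : Fock) :
    Summable (fun S => ‖c S * ψ (e S)‖ ^ 2) ∧
      ∑' S, ‖c S * ψ (e S)‖ ^ 2 ≤ ∑' S, ‖ψ S‖ ^ 2 := by
  have hψ : Summable (fun S => ‖ψ S‖ ^ 2) := by
    have := (lp.memℓp ψ).summable (by norm_num)
    simpa using this
  have hinj : Function.Injective (fun S : {S | c S ≠ 0} => e S) :=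
    fun S T h => Subtype.ext (he S.2 T.2 h)
  have h1 : Summable (fun S : {S | c S ≠ 0} => ‖ψ (e S)‖ ^ 2) :=
    hψ.comp_injective hinj
  have hle : ∀ S : Finset ℤ, ‖c S * ψ (e S)‖ ^ 2 ≤ ‖ψ (e S)‖ ^ 2 := by
    intro S
    rw [norm_mul]
    have := mul_le_of_le_one_left (norm_nonneg (ψ (e S))) (hc S)
    gcongr
  have h2 : Summable (fun S : {S | c S ≠ 0} => ‖c S * ψ (e S)‖ ^ 2) :=
    Summable.of_nonneg_of_le (fun _ => by positivity) (fun S => hle S) h1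
  have hsupp : Function.support (fun S => ‖c S * ψ (e S)‖ ^ 2) ⊆ {S | c S ≠ 0} := by
    intro S hS h0
    simp [h0] at hS
  have h3 : Summable (fun S => ‖c S * ψ (e S)‖ ^ 2) :=
    (hasSum_subtype_iff_of_support_subset hsupp).1 h2.hasSum |>.summable
  refine ⟨h3, ?_⟩
  rw [← tsum_subtype_eq_of_support_subset hsupp]
  refine (Summable.tsum_le_tsum (fun S : {S | c S ≠ 0} => hle S) h2 h1).trans ?_
  exact tsum_comp_le_tsum_of_inj hψ (fun _ => by positivity) hinj

/-- The bounded operator `(T ψ)(S) = c S * ψ (e S)`, for `|c| ≤ 1` and `e` injective on the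
support of `c`. -/
def weighted (e : Finset ℤ → Finset ℤ) (c : Finset ℤ → ℂ)
    (hc : ∀ S, ‖c S‖ ≤ 1) (he : Set.InjOn e {S | c S ≠ 0}) : FockOp :=
  LinearMap.mkContinuous
    { toFun := fun ψ => ⟨fun S => c S * ψ (e S), by
        refine memℓp_gen ?_
        simpa using (summable_weighted e c hc he ψ).1⟩
      map_add' := fun ψ φ => by
        ext S
        exact mul_add (c S) (ψ (e S)) (φ (e S))
      map_smul' := fun z ψ => by
        ext S
        simp [mul_left_comm] }
    1 (fun ψ => by
      rw [one_mul]
      refine lp.norm_le_of_tsum_le (by norm_num) (norm_nonneg _) ?_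
      rw [lp.norm_rpow_eq_tsum (by norm_num) ψ]
      simpa using (summable_weighted e c hc he ψ).2)

@[simp]
theorem weighted_apply (e : Finset ℤ → Finset ℤ) (c : Finset ℤ → ℂ)
    (hc : ∀ S, ‖c S‖ ≤ 1) (he : Set.InjOn e {S | c S ≠ 0}) (ψ : Fock) (S : Finset ℤ) :
    weighted e c hc he ψ S = c S * ψ (e S) := rfl

/-- The annihilation operator at the site `i`: on basis vectors
`a_i e_{S ∪ {i}} = (-1)^{#{j ∈ S : j < i}} e_S` for `i ∉ S`, and `a_i e_S = 0` for `i ∉ S`. -/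
def annihilation (i : ℤ) : FockOp :=
  weighted (fun S => insert i S)
    (fun S => if i ∈ S then 0 else (-1) ^ (S.filter (fun j => j < i)).card)
    (fun S => by split_ifs <;> simp)
    (by
      intro S hS T hT h
      have hS' : i ∉ S := fun h0 => hS (by simp [h0])
      have hT' : i ∉ T := fun h0 => hT (by simp [h0])
      have := congrArg (fun U => Finset.erase U i) h
      simpa [hS', hT'] using this)

theorem annihilation_apply (i : ℤ) (ψ : Fock) (S : Finset ℤ) :
    annihilation i ψ S =
      (if i ∈ S then 0 else (-1) ^ (S.filter (fun j => j < i)).card) * ψ (insert i S) := rfl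

theorem creation_apply (i : ℤ) (ψ : Fock) (S : Finset ℤ) :
    (star (annihilation i) : FockOp) ψ S =
      if i ∈ S then (-1) ^ (S.filter (fun j => j < i)).card * ψ (S.erase i) else 0 := by
  have h := ContinuousLinearMap.adjoint_inner_right (annihilation i)
    (lp.single 2 S (1 : ℂ)) ψ
  rw [lp.inner_single_left] at h
  rw [ContinuousLinearMap.star_eq_adjoint]
  simp only [RCLike.inner_apply, map_one, mul_one] at h
  rw [h, lp.inner_eq_tsum]
  by_cases hS : i ∈ S
  · rw [tsum_eq_single (S.erase i)]
    · have hf : (S.erase i).filter (fun j => j < i) = S.filter (fun j => j < i) := by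
        ext j
        simp only [Finset.mem_filter, Finset.mem_erase]
        constructor
        · rintro ⟨⟨_, h1⟩, h2⟩
          exact ⟨h1, h2⟩
        · rintro ⟨h1, h2⟩
          exact ⟨⟨h2.ne, h1⟩, h2⟩
      simp [annihilation_apply, hS, hf, mul_comm]
    · intro T hT
      rw [annihilation_apply]
      by_cases hiT : i ∈ T
      · simp [hiT]
      · have : insert i T ≠ S := by
          rintro rfl
          exact hT (by simp [hiT])
        simp [this]
  · rw [if_neg hS]
    convert tsum_zero with T
    rw [annihilation_apply]
    have : insert i T ≠ S := by
      rintro rfl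
      exact hS (by simp)
    simp [this]

theorem sign_insert {i j : ℤ} {S : Finset ℤ} (hj : j ∉ S) :
    ((-1 : ℂ)) ^ ((insert j S).filter (fun m => m < i)).card =
      (if j < i then -1 else 1) * (-1) ^ (S.filter (fun m => m < i)).card := by
  rw [Finset.filter_insert]
  split_ifs with h
  · rw [Finset.card_insert_of_notMem (by simp [hj]), pow_succ]
    ring
  · ring

/-- The canonical anticommutation relation `{a_i, a_j} = 0`. -/
theorem annihilation_anticomm (i j : ℤ) :
    annihilation i * annihilation j + annihilation j * annihilation i = 0 := by
  ext ψ S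
  change annihilation i (annihilation j ψ) S + annihilation j (annihilation i ψ) S = 0
  simp only [annihilation_apply]
  by_cases hi : i ∈ S
  · simp [hi]
  by_cases hj : j ∈ S
  · simp [hj]
  rcases lt_trichotomy i j with h | rfl | h
  · simp [hi, hj, h.ne, h.ne', sign_insert, h, h.not_gt, Finset.insert_comm j i S]
    ring
  · simp [hi]
  · simp [hi, hj, h.ne, h.ne', sign_insert, h, h.not_gt, Finset.insert_comm j i S]
    ring

/-- The canonical anticommutation relation `{a_i*, a_j} = δ_{ij}`. -/
theorem creation_annihilation (i j : ℤ) :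
    star (annihilation i) * annihilation j + annihilation j * star (annihilation i) =
      if i = j then 1 else 0 := by
  ext ψ S
  change (star (annihilation i) : FockOp) (annihilation j ψ) S +
    annihilation j ((star (annihilation i) : FockOp) ψ) S = _
  rw [creation_apply, annihilation_apply, annihilation_apply, creation_apply]
  have hsq : ∀ n : ℕ, ((-1 : ℂ)) ^ n * (-1) ^ n = 1 := fun n => by
    rw [← mul_pow]
    simp
  by_cases hij : i = j
  · subst hij
    have he : ((S.erase i).filter (fun m => m < i)) = S.filter (fun m => m < i) := by
      ext m
      simp only [Finset.mem_filter, Finset.mem_erase]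
      exact ⟨fun h => ⟨h.1.2, h.2⟩, fun h => ⟨⟨h.2.ne, h.1⟩, h.2⟩⟩
    have hi' : ((insert i S).filter (fun m => m < i)) = S.filter (fun m => m < i) := by
      rw [Finset.filter_insert]
      simp
    by_cases hi : i ∈ S
    · simp [hi, he, ← mul_assoc, hsq]
    · simp [hi, hi', ← mul_assoc, hsq]
  · rw [if_neg hij]
    change _ = (0 : ℂ)
    by_cases hj : j ∈ S
    · have : j ∈ S.erase i := Finset.mem_erase.2 ⟨Ne.symm hij, hj⟩
      simp [hj, this]
    by_cases hi : i ∈ S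
    · obtain ⟨T, hT, rfl⟩ : ∃ T, i ∉ T ∧ insert i T = S :=
        ⟨S.erase i, by simp, Finset.insert_erase hi⟩
      have hjT : j ∉ T := fun h => hj (Finset.mem_insert_of_mem h)
      have hc : (insert j (insert i T)).erase i = insert j T := by
        rw [Finset.insert_comm, Finset.erase_insert]
        simp [hT, hij]
      rw [hc, Finset.erase_insert hT, sign_insert hj, sign_insert hT, sign_insert hT]
      rcases lt_or_gt_of_ne hij with h | h
      · simp [hjT, hj, h, h.not_gt]
        ring
      · simp [hjT, hj, h, h.not_gt]
        ring
    · have : i ∉ insert j S := by simp [hi, hij]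
      simp [hi, this]

/-- The parity operator `(-1)^F`, with `F` the total fermion number. -/
def parity : FockOp :=
  weighted id (fun S => (-1) ^ S.card) (fun S => by simp) (Function.injective_id.injOn)

theorem parity_apply (ψ : Fock) (S : Finset ℤ) : parity ψ S = (-1) ^ S.card * ψ S := rfl

theorem parity_mul_parity : parity * parity = 1 := by
  ext ψ S
  simp [parity_apply, ← mul_assoc, ← mul_pow]

theorem star_parity : star parity = parity := by
  rw [ContinuousLinearMap.star_eq_adjoint, eq_comm, ContinuousLinearMap.eq_adjoint_iff]
  intro ψ φ
  simp only [lp.inner_eq_tsum]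
  refine tsum_congr fun S => ?_
  simp [parity_apply]
  ring

theorem parity_conj_annihilation (i : ℤ) :
    parity * annihilation i * parity = -annihilation i := by
  ext ψ S
  change parity (annihilation i (parity ψ)) S = -(annihilation i ψ S)
  rw [parity_apply, annihilation_apply, parity_apply, annihilation_apply]
  by_cases h : i ∈ S
  · simp [h]
  · have h2 : ((-1 : ℂ) ^ S.card) * (-1) ^ S.card = 1 := by
      rw [← mul_pow]
      simp
    simp only [h, if_false, Finset.card_insert_of_notMem h, pow_succ]
    linear_combination (-(-1) ^ (S.filter (fun j => j < i)).card * ψ (insert i S)) * h2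

/-! ### The CAR algebra -/

/-- The CAR algebra over `ℤ`: the norm closure of the unital `*`-algebra generated by the
fermion operators. -/
def carAlgebra : StarSubalgebra ℂ FockOp :=
  (StarAlgebra.adjoin ℂ (Set.range annihilation)).topologicalClosure

/-- The C*-algebra `𝒜` as a type. -/
abbrev CAR : Type := carAlgebra

/-- The annihilation operator `a_i` as an element of `𝒜`; the creation operator is `star (a i)`. -/
def a (i : ℤ) : CAR :=
  ⟨annihilation i, StarSubalgebra.le_topologicalClosure _
    (StarAlgebra.subset_adjoin ℂ _ ⟨i, rfl⟩)⟩

theorem parity_conj_mem {x : FockOp} (hx : x ∈ carAlgebra) :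
    parity * x * parity ∈ carAlgebra := by
  have hcont : Continuous (fun y : FockOp => parity * y * parity) := by fun_prop
  refine map_mem_closure (f := fun y : FockOp => parity * y * parity) hcont hx ?_
  intro y hy
  change parity * y * parity ∈ StarAlgebra.adjoin ℂ (Set.range annihilation)
  induction hy using StarAlgebra.adjoin_induction with
  | mem x hx =>
    obtain ⟨i, rfl⟩ := hx
    rw [parity_conj_annihilation]
    exact neg_mem (StarAlgebra.subset_adjoin ℂ _ ⟨i, rfl⟩)
  | algebraMap r =>
    have : parity * algebraMap ℂ FockOp r * parity = algebraMap ℂ FockOp r := by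
      rw [← Algebra.commutes, mul_assoc, parity_mul_parity, mul_one]
    rw [this]
    exact algebraMap_mem _ r
  | add x y _ _ hx hy =>
    rw [mul_add, add_mul]
    exact add_mem hx hy
  | mul x y _ _ hx hy =>
    have : parity * (x * y) * parity = (parity * x * parity) * (parity * y * parity) := by
      calc parity * (x * y) * parity = parity * x * 1 * y * parity := by noncomm_ring
        _ = _ := by
          rw [← parity_mul_parity]
          noncomm_ring
    rw [this]
    exact mul_mem hx hy
  | star x _ hx =>
    have : parity * star x * parity = star (parity * x * parity) := by
      simp [star_mul, star_parity, mul_assoc]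
    rw [this]
    exact star_mem hx

/-- The grading automorphism `γ = Ad (-1)^F` of `𝒜`. -/
def grading (x : CAR) : CAR := ⟨parity * x.1 * parity, parity_conj_mem x.2⟩

/-- `γ(a_i) = -a_i`. -/
theorem grading_a (i : ℤ) : grading (a i) = -a i :=
  Subtype.ext (parity_conj_annihilation i)

/-- The algebra `𝒜(I)` of the finite region `I`. -/
def localAlgebra (I : Finset ℤ) : StarSubalgebra ℂ CAR :=
  StarAlgebra.adjoin ℂ (a '' (I : Set ℤ))

/-- The local algebra `𝒜_∘`, the union of all `𝒜(I)` with `I` finite. -/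
def localElements : Set CAR := ⋃ I : Finset ℤ, (localAlgebra I : Set CAR)

/-! ### The Nicolai model -/

/-- The local supercharge `q({2i-1, 2i, 2i+1}) = a_{2i+1} a*_{2i} a_{2i-1}`. -/
def q (i : ℤ) : CAR := a (2 * i + 1) * star (a (2 * i)) * a (2 * i - 1)

/-- The graded commutator `[x, A]_γ` with an odd element `x`: it is the commutator `xA - Ax` for
even `A`, and the anticommutator `xA + Ax` for odd `A`. -/
def oddCommutator (x A : CAR) : CAR := x * A - grading A * x

/-- The superderivation `δ(A) = [Q_Nic, A]_γ` with `Q_Nic = ∑ i, q i`. For `A` in the local algebra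
only finitely many terms are nonzero. -/
def delta (A : CAR) : CAR := ∑ᶠ i : ℤ, oddCommutator (q i) A

/-- The superderivation `δ*(A) = [Q_Nic*, A]_γ`. -/
def deltaStar (A : CAR) : CAR := ∑ᶠ i : ℤ, oddCommutator (star (q i)) A

/-- The derivation `d = δ* δ + δ δ*`, i.e. `d(A) = [H_Nic, A]` with
`H_Nic = Q_Nic Q_Nic* + Q_Nic* Q_Nic`, on the local algebra. -/
def d (A : CAR) : CAR := deltaStar (delta A) + delta (deltaStar A)

/-- `α` is the Heisenberg time evolution of the Nicolai model: the strongly continuous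
one-parameter group of `*`-automorphisms of `𝒜` with pre-generator `i d` on the local algebra,
that is, whose generator `A ↦ (d/dt) α_t(A) |_{t = 0}` (with domain all `A` for which the norm
derivative exists) is the closure of `A ↦ i [H_Nic, A]`, `A ∈ 𝒜_∘`. -/
structure IsTimeEvolution (α : ℝ → (CAR ≃⋆ₐ[ℂ] CAR)) : Prop where
  zero : ∀ A, α 0 A = A
  add : ∀ s t A, α (s + t) A = α s (α t A)
  continuous : ∀ A, Continuous (fun t => α t A)
  generator : {p : CAR × CAR | HasDerivAt (fun t : ℝ => α t p.1) p.2 0} =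
    closure {p : CAR × CAR | p.1 ∈ localElements ∧ p.2 = Complex.I • d p.1}

/-! ### Sequences of conservation and the associated operators -/

/-- The restriction of `f` to the interval `[m, n]` is permitted: no triple
`{2i-1, 2i, 2i+1} ⊆ [m, n]` carries the pattern `-+-` or `+-+`. -/
def IsPermitted (m n : ℤ) (f : ℤ → ℤˣ) : Prop :=
  ∀ i : ℤ, m ≤ 2 * i - 1 → 2 * i + 1 ≤ n →
    ¬ (f (2 * i - 1) = -1 ∧ f (2 * i) = 1 ∧ f (2 * i + 1) = -1) ∧
    ¬ (f (2 * i - 1) = 1 ∧ f (2 * i) = -1 ∧ f (2 * i + 1) = 1)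

/-- The restriction of `f` to `[2k, 2l]`, `k < l`, is a local sequence of conservation: it is
permitted and constant on each of the edge pairs. Values outside `[2k, 2l]` play no role. -/
structure IsConservation (k l : ℤ) (f : ℤ → ℤˣ) : Prop where
  lt : k < l
  permitted : IsPermitted (2 * k) (2 * l) f
  left_edge : f (2 * k) = f (2 * k + 1)
  right_edge : f (2 * l - 1) = f (2 * l)

/-- `ζ_i(-1) = a_i`, `ζ_i(+1) = a_i*`. -/
def zeta (i : ℤ) (s : ℤˣ) : CAR := if s = 1 then star (a i) else a i

/-- The monomial `ζ_{2k}(f(2k)) ζ_{2k+1}(f(2k+1)) ⋯ ζ_{2l}(f(2l))`, in increasing order. -/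
def monomialQ (k l : ℤ) (f : ℤ → ℤˣ) : CAR :=
  ((List.range (2 * (l - k) + 1).toNat).map
    (fun j : ℕ => zeta (2 * k + j) (f (2 * k + j)))).prod

/-- The `*`-algebra `𝒞` generated by all `Q(f)`. -/
def constantsOfMotion : StarSubalgebra ℂ CAR :=
  StarAlgebra.adjoin ℂ {x | ∃ k l f, IsConservation k l f ∧ x = monomialQ k l f}

end

end Nicolai

set_option linter.unusedSectionVars false

/-! The existence of the evolution and the conservation laws are proved independently.

Existence. On elements localized in `box N`, `d` agrees with the commutator by the finite-volume
Hamiltonian `boxHamiltonian L` once `N + 2 ≤ L` (`d_eq`). The lattice is one-dimensional and distant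
supercharges anticommute, so this commutator has norm O(N) on `box N` and enlarges the box by a
fixed amount. Hence n-fold commutators grow at most like n! times a power c^n, uniformly in L, and
the exponential series of a local element converges for small |t|. The finite-volume flows are
isometric, so their limits exist on all of `CAR`, and the group law carries them to all times. Local
elements are analytic vectors of the limit flow; together with closedness of the generator this
shows that they form a core (`generator_limitFlow`).

Conservation. Each supercharge q_i or q_i* that meets the support of the monomial Q(f) contains a
fermion operator that is also a factor of Q(f): the forbidden patterns and the two edge conditions
say exactly this (`IsConservation.exists_match`). That operator has square zero and anticommutes
with the other factors, so both products of the supercharge with Q(f) vanish. The remaining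
supercharges graded-commute with Q(f) by locality. Thus δ and δ* both annihilate Q(f), and d(Q(f)) =
0. Any evolution with the prescribed generator then has zero derivative along Q(f) at every time,
and the fixed points of a *-automorphism form a *-algebra. -/

namespace Nicolai

noncomputable section

/-! ### Exponentials of bounded operators. -/

section ExponentialFlow

open NormedSpace

variable {F : Type*} [NormedAddCommGroup F] [NormedSpace ℂ F] [CompleteSpace F]

/-- The flow `x ↦ exp(tD) x` of a bounded linear operator. -/
def exponentialFlow (D : F →L[ℂ] F) (t : ℝ) (x : F) : F := exp ((t : ℂ) • D) x

theorem exponentialFlow_zero (D : F →L[ℂ] F) (x : F) : exponentialFlow D 0 x = x := by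
  simp [exponentialFlow]

theorem hasSum_exponentialFlow (D : F →L[ℂ] F) (t : ℝ) (x : F) :
    HasSum (fun n : ℕ => ((t : ℂ) ^ n / n.factorial) • (D ^ n) x) (exponentialFlow D t x) := by
  have h := (ContinuousLinearMap.apply ℂ F x).hasSum
    (exp_series_hasSum_exp' (𝕂 := ℂ) ((t : ℂ) • D))
  convert! h using 1
  ext n
  simp only [smul_pow, smul_smul, div_eq_inv_mul]
  rfl

theorem hasDerivAt_exponentialFlow (D : F →L[ℂ] F) (t : ℝ) (x : F) :
    HasDerivAt (fun s => exponentialFlow D s x) (D (exponentialFlow D t x)) t := by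
  have h1 : HasDerivAt (fun u : ℝ => exp ((u : ℂ) • D)) (D * exp ((t : ℂ) • D)) t := by
    simpa using! (hasDerivAt_exp_smul_const' (𝕂 := ℂ) D (t : ℂ)).scomp t
      Complex.ofRealCLM.hasDerivAt
  exact ((ContinuousLinearMap.apply ℂ F x).restrictScalars ℝ).hasFDerivAt.comp_hasDerivAt t h1

end ExponentialFlow

/-! ### Inner flows on a C*-algebra -/

section InnerFlow

open NormedSpace Filter Topology

variable {B : Type*} [NormedRing B] [StarRing B] [CStarRing B] [NormedAlgebra ℂ B] [StarModule ℂ B]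
  [CompleteSpace B]

/-- The inner derivation `x ↦ X x - x X`. -/
def innerDerivation (X : B) : B →L[ℂ] B :=
  ContinuousLinearMap.mul ℂ B X - (ContinuousLinearMap.mul ℂ B).flip X

@[simp]
theorem innerDerivation_apply (X x : B) : innerDerivation X x = X * x - x * X := rfl

/-- The flow `x ↦ exp(tX) x exp(-tX)`. -/
def innerFlow (X : B) (t : ℝ) (x : B) : B := exp (t • X) * x * exp (t • -X)

theorem exp_smul_mul_exp_smul_neg (X : B) (t : ℝ) : exp (t • X) * exp (t • -X) = 1 := by
  let : NormedAlgebra ℚ B := .restrictScalars ℚ ℂ B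
  rw [smul_neg, ← exp_add_of_commute (Commute.neg_right rfl), add_neg_cancel, exp_zero]

theorem exp_smul_neg_mul_exp_smul (X : B) (t : ℝ) : exp (t • -X) * exp (t • X) = 1 := by
  simpa using exp_smul_mul_exp_smul_neg (-X) t

theorem exp_add_smul (X : B) (s t : ℝ) : exp ((s + t) • X) = exp (s • X) * exp (t • X) := by
  let : NormedAlgebra ℚ B := .restrictScalars ℚ ℂ B
  rw [add_smul, exp_add_of_commute (((Commute.refl X).smul_left s).smul_right t)]

theorem innerFlow_zero (X x : B) : innerFlow X 0 x = x := by
  simp [innerFlow]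

theorem innerFlow_add_time (X : B) (s t : ℝ) (x : B) :
    innerFlow X (s + t) x = innerFlow X s (innerFlow X t x) := by
  unfold innerFlow
  rw [exp_add_smul X, add_comm s t, exp_add_smul (-X)]
  noncomm_ring

theorem innerFlow_mul (X : B) (t : ℝ) (x y : B) :
    innerFlow X t (x * y) = innerFlow X t x * innerFlow X t y := by
  unfold innerFlow
  calc _ = exp (t • X) * x * 1 * y * exp (t • -X) := by noncomm_ring
    _ = _ := by
      rw [← exp_smul_neg_mul_exp_smul X t]
      noncomm_ring

theorem innerFlow_add (X : B) (t : ℝ) (x y : B) :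
    innerFlow X t (x + y) = innerFlow X t x + innerFlow X t y := by
  simp [innerFlow, mul_add, add_mul]

theorem innerFlow_sub (X : B) (t : ℝ) (x y : B) :
    innerFlow X t (x - y) = innerFlow X t x - innerFlow X t y := by
  simp [innerFlow, mul_sub, sub_mul]

theorem innerFlow_smul (X : B) (t : ℝ) (c : ℂ) (x : B) :
    innerFlow X t (c • x) = c • innerFlow X t x := by
  simp [innerFlow]

theorem star_exp_smul {X : B} (hX : star X = -X) (t : ℝ) :
    star (exp (t • X)) = exp (t • -X) := by
  rw [star_exp, star_smul, hX, star_trivial]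

theorem innerFlow_star {X : B} (hX : star X = -X) (t : ℝ) (x : B) :
    innerFlow X t (star x) = star (innerFlow X t x) := by
  have h : star (exp (t • -X)) = exp (t • X) := by
    rw [← star_exp_smul hX, star_star]
  simp only [innerFlow, star_mul, h, star_exp_smul hX, mul_assoc]

theorem exp_smul_mem_unitary {X : B} (hX : star X = -X) (t : ℝ) :
    exp (t • X) ∈ unitary B := by
  rw [Unitary.mem_iff, star_exp_smul hX]
  exact ⟨exp_smul_neg_mul_exp_smul X t, exp_smul_mul_exp_smul_neg X t⟩

theorem norm_innerFlow {X : B} (hX : star X = -X) (t : ℝ) (x : B) :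
    ‖innerFlow X t x‖ = ‖x‖ := by
  have hX' : star (-X) = -(-X) := by rw [star_neg, hX]
  rw [innerFlow, CStarRing.norm_mul_mem_unitary _ (exp_smul_mem_unitary hX' t),
    CStarRing.norm_mem_unitary_mul _ (exp_smul_mem_unitary hX t)]

theorem hasDerivAt_innerFlow (X : B) (t : ℝ) (x : B) :
    HasDerivAt (fun s => innerFlow X s x) (innerFlow X t (innerDerivation X x)) t := by
  have h1 := (hasDerivAt_exp_smul_const (𝕂 := ℝ) X t).mul_const x
  have h2 := hasDerivAt_exp_smul_const' (𝕂 := ℝ) (-X) t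
  convert! h1.mul h2 using 1
  simp only [innerFlow, innerDerivation_apply]
  noncomm_ring

theorem continuous_innerFlow (X x : B) : Continuous (fun s => innerFlow X s x) :=
  continuous_iff_continuousAt.2 fun t => (hasDerivAt_innerFlow X t x).continuousAt

/-- Turns conjugation by exp(tX) into a power series in the derivation, the form in which iterated
commutators can be estimated. Both sides solve T' = XT - TX with the same initial value. -/
theorem exponentialFlow_innerDerivation (X : B) (t : ℝ) (x : B) :
    exponentialFlow (innerDerivation X) t x = innerFlow X t x := by
  set T : ℝ → B := fun s => exponentialFlow (innerDerivation X) s x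
  have hT : ∀ s, HasDerivAt T (X * T s - T s * X) s := fun s =>
    hasDerivAt_exponentialFlow (innerDerivation X) s x
  -- Undoing the conjugation on the solution T gives a constant function.
  set g : ℝ → B := fun s => exp (s • -X) * T s * exp (s • X)
  have hg : ∀ s, HasDerivAt g 0 s := fun s => by
    have h := ((hasDerivAt_exp_smul_const (𝕂 := ℝ) (-X) s).mul (hT s)).mul
      (hasDerivAt_exp_smul_const' (𝕂 := ℝ) X s)
    convert! h using 1
    simp only [Pi.mul_apply]
    noncomm_ring
  have hc : g t = g 0 :=
    is_const_of_deriv_eq_zero (fun s => (hg s).differentiableAt) (fun s => (hg s).deriv) t 0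
  have h0 : g 0 = x := by simp [g, T, exponentialFlow_zero]
  have ht : innerFlow X t (g t) = T t := by
    simp only [innerFlow, g]
    calc _ = (exp (t • X) * exp (t • -X)) * T t * (exp (t • X) * exp (t • -X)) := by
          noncomm_ring
      _ = _ := by rw [exp_smul_mul_exp_smul_neg, one_mul, mul_one]
  change T t = _
  rw [← ht, hc, h0]

theorem hasSum_innerFlow (X : B) (t : ℝ) (x : B) :
    HasSum (fun n : ℕ => ((t : ℂ) ^ n / n.factorial) • (innerDerivation X ^ n) x)
      (innerFlow X t x) :=
  exponentialFlow_innerDerivation X t x ▸ hasSum_exponentialFlow (innerDerivation X) t x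

end InnerFlow

end

end Nicolai

namespace Nicolai

noncomputable section

/-! ### Limits of inner flows -/

open Filter Topology

variable {B : Type*} [NormedRing B] [StarRing B] [CStarRing B] [NormedAlgebra ℂ B] [StarModule ℂ B]
  [CompleteSpace B]

/-- Inner skew-adjoint derivations `ad (X L)` that stabilize to `D` on an increasing family `S N`
of subspaces with dense union, raise `N` by at most `r`, and have norm `O(N)` on `S N`. -/
structure IsFiniteRangeApprox (X : ℕ → B) (S : ℕ → Submodule ℂ B) (D : B → B) (r : ℕ) (C : ℝ) :
    Prop where
  skew : ∀ L, star (X L) = -X L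
  mono : Monotone S
  dense : Dense (⋃ N, (S N : Set B))
  one_le : 1 ≤ r
  pos : 0 < C
  mem : ∀ L N A, A ∈ S N → innerDerivation (X L) A ∈ S (N + r)
  bound : ∀ L N A, A ∈ S N → ‖innerDerivation (X L) A‖ ≤ C * (N + 1) * ‖A‖
  eq : ∀ L N A, A ∈ S N → N + r ≤ L → innerDerivation (X L) A = D A

namespace IsFiniteRangeApprox

variable {X : ℕ → B} {S : ℕ → Submodule ℂ B} {D : B → B} {r : ℕ} {C : ℝ}
  (h : IsFiniteRangeApprox X S D r C)

include h

theorem pow_mem (L n N : ℕ) {A : B} (hA : A ∈ S N) :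
    (innerDerivation (X L) ^ n) A ∈ S (N + r * n) := by
  induction n with
  | zero => simpa using hA
  | succ n ih =>
    rw [pow_succ', Nat.mul_succ, ← add_assoc]
    exact h.mem L _ _ ih

/-- After j commutators the element lies in S (N + r j), so the next one costs a factor C (N + r j +
1) ≤ C r (N + 1 + j), because r ≥ 1. The product of these factors is a rising factorial. -/
theorem norm_pow_le (L n N : ℕ) {A : B} (hA : A ∈ S N) :
    ‖(innerDerivation (X L) ^ n) A‖ ≤ (C * r) ^ n * (N + 1).ascFactorial n * ‖A‖ := by
  have hC := h.pos
  have hr : (1 : ℝ) ≤ r := by exact_mod_cast h.one_le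
  induction n with
  | zero => simp
  | succ n ih =>
    rw [pow_succ']
    refine (h.bound L _ _ (h.pow_mem L n N hA)).trans ?_
    have h1 : C * (((N + r * n : ℕ) : ℝ) + 1) ≤ C * r * (N + 1 + n) := by
      rw [mul_assoc]
      refine mul_le_mul_of_nonneg_left ?_ hC.le
      push_cast
      nlinarith [Nat.cast_nonneg (α := ℝ) N]
    calc _ ≤ C * r * (N + 1 + n) * ((C * r) ^ n * (N + 1).ascFactorial n * ‖A‖) := by
          gcongr
      _ = _ := by
        rw [Nat.ascFactorial_succ]
        push_cast
        ring

/-- The rising factorial divided by n! is a binomial coefficient, at most 2^(N + n). This leaves a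
geometric series of ratio 2 C r |t| that does not depend on L. -/
theorem norm_pow_div_factorial_le (L n N : ℕ) {A : B} (hA : A ∈ S N) (t : ℝ) :
    ‖((t : ℂ) ^ n / n.factorial) • (innerDerivation (X L) ^ n) A‖ ≤
      2 ^ N * ‖A‖ * (2 * C * r * |t|) ^ n := by
  have hC := h.pos
  have hchoose : ((N + n).choose n : ℝ) ≤ 2 ^ (N + n) := by
    exact_mod_cast Nat.choose_le_two_pow (N + n) n
  have hfac : (0 : ℝ) < n.factorial := by exact_mod_cast n.factorial_pos
  have h1 := h.norm_pow_le L n N hA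
  rw [Nat.ascFactorial_eq_factorial_mul_choose] at h1
  rw [Nat.cast_mul] at h1
  rw [norm_smul, norm_div, norm_pow, Complex.norm_real, Real.norm_eq_abs, Complex.norm_natCast]
  calc _ ≤ |t| ^ n / n.factorial *
        ((C * r) ^ n * (n.factorial * (2 : ℝ) ^ (N + n)) * ‖A‖) := by
        refine mul_le_mul_of_nonneg_left (h1.trans ?_) (by positivity)
        gcongr
    _ = _ := by
      field_simp
      ring

theorem iterate_eq (L n N : ℕ) {A : B} (hA : A ∈ S N) (hL : N + r * n ≤ L) :
    (innerDerivation (X L) ^ n) A = D^[n] A := by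
  induction n with
  | zero => simp
  | succ n ih =>
    have hL' : N + r * n + r ≤ L := by rwa [Nat.mul_succ, ← add_assoc] at hL
    rw [Function.iterate_succ_apply', ← ih (by omega), pow_succ']
    exact h.eq L _ _ (h.pow_mem L n N hA) hL'

theorem iterate_mem (n N : ℕ) {A : B} (hA : A ∈ S N) : D^[n] A ∈ S (N + r * n) := by
  rw [← h.iterate_eq _ n N hA le_rfl]
  exact h.pow_mem _ n N hA

theorem tendsto_pow (n N : ℕ) {A : B} (hA : A ∈ S N) :
    Tendsto (fun L => (innerDerivation (X L) ^ n) A) atTop (𝓝 (D^[n] A)) :=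
  tendsto_const_nhds.congr' <| (eventually_ge_atTop (N + r * n)).mono fun L hL =>
    (h.iterate_eq L n N hA hL).symm

theorem summable_bound (N : ℕ) (A : B) {t : ℝ} (ht : 2 * C * r * |t| < 1) :
    Summable (fun n : ℕ => 2 ^ N * ‖A‖ * (2 * C * r * |t|) ^ n) := by
  have hC := h.pos
  exact (summable_geometric_of_lt_one (by positivity) ht).mul_left _

theorem summable_series {N : ℕ} {A : B} (hA : A ∈ S N) {t : ℝ} (ht : 2 * C * r * |t| < 1) :
    Summable (fun n : ℕ => ((t : ℂ) ^ n / n.factorial) • D^[n] A) := by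
  refine Summable.of_norm_bounded (h.summable_bound N A ht) fun n => ?_
  rw [← h.iterate_eq _ n N hA le_rfl]
  exact h.norm_pow_div_factorial_le _ n N hA t

/-- Each term of the series is eventually constant in L, and the geometric bound is uniform in L, so
the limit may be taken termwise. -/
theorem tendsto_innerFlow_series {N : ℕ} {A : B} (hA : A ∈ S N) {t : ℝ}
    (ht : 2 * C * r * |t| < 1) :
    Tendsto (fun L => innerFlow (X L) t A) atTop
      (𝓝 (∑' n : ℕ, ((t : ℂ) ^ n / n.factorial) • D^[n] A)) := by
  simp_rw [fun L => (hasSum_innerFlow (X L) t A).tsum_eq.symm]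
  refine tendsto_tsum_of_dominated_convergence (h.summable_bound N A ht) (fun n => ?_)
    (Eventually.of_forall fun L n => h.norm_pow_div_factorial_le L n N hA t)
  exact (h.tendsto_pow n N hA).const_smul _

theorem norm_innerFlow_sub (L : ℕ) (t : ℝ) (x y : B) :
    ‖innerFlow (X L) t x - innerFlow (X L) t y‖ = ‖x - y‖ := by
  rw [← innerFlow_sub, norm_innerFlow (h.skew L)]

theorem exists_local_near (x : B) {ε : ℝ} (hε : 0 < ε) : ∃ N, ∃ A ∈ S N, ‖x - A‖ < ε := by
  obtain ⟨A, hA, hd⟩ := h.dense.exists_dist_lt x hε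
  obtain ⟨N, hN⟩ := Set.mem_iUnion.1 hA
  exact ⟨N, A, hN, by rwa [← dist_eq_norm]⟩

/-- Convergence passes from local elements to their closure by an ε/3 argument, since all the inner
flows are isometric. -/
theorem exists_limit_of_small {t : ℝ} (ht : 2 * C * r * |t| < 1) (x : B) :
    ∃ y, Tendsto (fun L => innerFlow (X L) t x) atTop (𝓝 y) := by
  refine cauchySeq_tendsto_of_complete (Metric.cauchySeq_iff'.2 fun ε hε => ?_)
  obtain ⟨N, A, hA, hx⟩ := h.exists_local_near x (ε := ε / 3) (by positivity)
  obtain ⟨L₀, hL₀⟩ := Metric.cauchySeq_iff'.1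
    (h.tendsto_innerFlow_series hA ht).cauchySeq (ε / 3) (by positivity)
  refine ⟨L₀, fun L hL => ?_⟩
  have h1 := hL₀ L hL
  have h2 := h.norm_innerFlow_sub L t x A
  have h3 := h.norm_innerFlow_sub L₀ t A x
  rw [norm_sub_rev A x] at h3
  rw [dist_eq_norm] at h1 ⊢
  calc _ = ‖(innerFlow (X L) t x - innerFlow (X L) t A) +
        (innerFlow (X L) t A - innerFlow (X L₀) t A) +
        (innerFlow (X L₀) t A - innerFlow (X L₀) t x)‖ := by congr 1; abel
    _ ≤ _ := norm_add₃_le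
    _ < ε := by linarith

/-- By isometry of the outer flow, the inner flow may be replaced by its limit y before the outer
limit is taken. -/
theorem tendsto_innerFlow_comp {s t : ℝ} {x y z : B}
    (hy : Tendsto (fun L => innerFlow (X L) t x) atTop (𝓝 y))
    (hz : Tendsto (fun L => innerFlow (X L) s y) atTop (𝓝 z)) :
    Tendsto (fun L => innerFlow (X L) (s + t) x) atTop (𝓝 z) := by
  have h0 : Tendsto (fun L => innerFlow (X L) s (innerFlow (X L) t x) - innerFlow (X L) s y)
      atTop (𝓝 0) := by
    rw [tendsto_zero_iff_norm_tendsto_zero]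
    simp_rw [h.norm_innerFlow_sub]
    exact tendsto_iff_norm_sub_tendsto_zero.1 hy
  simpa [innerFlow_add_time] using h0.add hz

theorem exists_limit (t : ℝ) (x : B) :
    ∃ y, Tendsto (fun L => innerFlow (X L) t x) atTop (𝓝 y) := by
  have hC := h.pos
  -- The time t is cut into n steps, each inside the radius of convergence; the radius is the same
  -- for all local elements.
  obtain ⟨n, hn⟩ := exists_nat_gt (2 * C * r * |t|)
  have hn0 : (0 : ℝ) < n := lt_of_le_of_lt (by positivity) hn
  have hsmall : 2 * C * r * |t / n| < 1 := by
    rw [abs_div, Nat.abs_cast, ← mul_div_assoc, div_lt_one hn0]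
    exact hn
  have key : ∀ m : ℕ, ∀ x : B, ∃ y,
      Tendsto (fun L => innerFlow (X L) (m * (t / n)) x) atTop (𝓝 y) := by
    intro m
    induction m with
    | zero => exact fun x => ⟨x, by simp [innerFlow_zero]⟩
    | succ m ih =>
      intro x
      obtain ⟨y, hy⟩ := h.exists_limit_of_small hsmall x
      obtain ⟨z, hz⟩ := ih y
      refine ⟨z, ?_⟩
      have := h.tendsto_innerFlow_comp hy hz
      rwa [show (m : ℝ) * (t / n) + t / n = ((m + 1 : ℕ) : ℝ) * (t / n) by push_cast; ring] at this
  have := key n x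
  rwa [mul_div_cancel₀ t hn0.ne'] at this

omit h in
/-- The pointwise limit of the inner flows. -/
def limitFlow (h : IsFiniteRangeApprox X S D r C) (t : ℝ) (x : B) : B := (h.exists_limit t x).choose

theorem tendsto_limitFlow (t : ℝ) (x : B) :
    Tendsto (fun L => innerFlow (X L) t x) atTop (𝓝 (h.limitFlow t x)) :=
  (h.exists_limit t x).choose_spec

theorem limitFlow_eq {t : ℝ} {x y : B}
    (hy : Tendsto (fun L => innerFlow (X L) t x) atTop (𝓝 y)) : h.limitFlow t x = y :=
  tendsto_nhds_unique (h.tendsto_limitFlow t x) hy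

theorem limitFlow_zero (x : B) : h.limitFlow 0 x = x :=
  h.limitFlow_eq (by simp [innerFlow_zero])

theorem limitFlow_add_time (s t : ℝ) (x : B) :
    h.limitFlow (s + t) x = h.limitFlow s (h.limitFlow t x) :=
  h.limitFlow_eq (h.tendsto_innerFlow_comp (h.tendsto_limitFlow t x) (h.tendsto_limitFlow s _))

theorem limitFlow_mul (t : ℝ) (x y : B) :
    h.limitFlow t (x * y) = h.limitFlow t x * h.limitFlow t y :=
  h.limitFlow_eq (by
    simp_rw [innerFlow_mul]
    exact (h.tendsto_limitFlow t x).mul (h.tendsto_limitFlow t y))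

theorem limitFlow_add (t : ℝ) (x y : B) :
    h.limitFlow t (x + y) = h.limitFlow t x + h.limitFlow t y :=
  h.limitFlow_eq (by
    simp_rw [innerFlow_add]
    exact (h.tendsto_limitFlow t x).add (h.tendsto_limitFlow t y))

theorem limitFlow_smul (t : ℝ) (c : ℂ) (x : B) :
    h.limitFlow t (c • x) = c • h.limitFlow t x :=
  h.limitFlow_eq (by
    simp_rw [innerFlow_smul]
    exact (h.tendsto_limitFlow t x).const_smul c)

theorem limitFlow_star (t : ℝ) (x : B) :
    h.limitFlow t (star x) = star (h.limitFlow t x) :=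
  h.limitFlow_eq (by
    simp_rw [fun L => innerFlow_star (h.skew L) t x]
    exact (h.tendsto_limitFlow t x).star)

theorem norm_limitFlow (t : ℝ) (x : B) : ‖h.limitFlow t x‖ = ‖x‖ :=
  tendsto_nhds_unique (h.tendsto_limitFlow t x).norm
    (by simp [fun L => norm_innerFlow (h.skew L) t x])

omit h in
/-- The limit flow as a family of `*`-automorphisms. -/
def limitAut (h : IsFiniteRangeApprox X S D r C) (t : ℝ) : B ≃⋆ₐ[ℂ] B where
  toFun := h.limitFlow t
  invFun := h.limitFlow (-t)
  left_inv x := by rw [← h.limitFlow_add_time, neg_add_cancel, h.limitFlow_zero]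
  right_inv x := by rw [← h.limitFlow_add_time, add_neg_cancel, h.limitFlow_zero]
  map_mul' := h.limitFlow_mul t
  map_add' := h.limitFlow_add t
  map_star' := h.limitFlow_star t
  map_smul' := h.limitFlow_smul t

omit h in
/-- The limit flow as a family of bounded operators. -/
def limitClm (h : IsFiniteRangeApprox X S D r C) (t : ℝ) : B →L[ℂ] B :=
  LinearMap.mkContinuous
    { toFun := h.limitFlow t
      map_add' := h.limitFlow_add t
      map_smul' := h.limitFlow_smul t } 1 (fun x => by
        rw [one_mul]
        exact (h.norm_limitFlow t x).le)

theorem limitFlow_sub (t : ℝ) (x y : B) :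
    h.limitFlow t (x - y) = h.limitFlow t x - h.limitFlow t y :=
  map_sub (h.limitClm t) x y

theorem limitFlow_eq_tsum {N : ℕ} {A : B} (hA : A ∈ S N) {t : ℝ} (ht : 2 * C * r * |t| < 1) :
    h.limitFlow t A = ∑' n : ℕ, ((t : ℂ) ^ n / n.factorial) • D^[n] A :=
  h.limitFlow_eq (h.tendsto_innerFlow_series hA ht)

end IsFiniteRangeApprox

end

end Nicolai

namespace Nicolai

noncomputable section

/-! ### The generator of the limit flow -/

open Filter Topology MeasureTheory

/-- A closed subspace is closed and convex, hence contains the average of f over the interval; the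
integral is a multiple of it. -/
theorem intervalIntegral_mem_of_isClosed {E : Type*} [NormedAddCommGroup E] [NormedSpace ℝ E]
    [CompleteSpace E] (K : Submodule ℝ E) (hK : IsClosed (K : Set E)) {f : ℝ → E}
    (hf : Continuous f) {a b : ℝ} (hab : a < b) (hmem : ∀ s ∈ Set.Ioc a b, f s ∈ K) :
    ∫ s in a..b, f s ∈ K := by
  have hv : volume.real (Set.Ioc a b) ≠ 0 := by
    simpa [Measure.real, hab.le] using (sub_pos.2 hab).ne'
  have h := K.convex.set_average_mem (μ := volume) (t := Set.Ioc a b) (f := f) hK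
    (by simpa using hab) (by simp)
    ((ae_restrict_iff' measurableSet_Ioc).2 (Eventually.of_forall hmem))
    (hf.integrableOn_Ioc)
  rw [setAverage_eq] at h
  rw [intervalIntegral.integral_of_le hab.le]
  have h2 := K.smul_mem (volume.real (Set.Ioc a b)) h
  rwa [smul_smul, mul_inv_cancel₀ hv, one_smul] at h2

variable {B : Type*} [NormedRing B] [StarRing B] [CStarRing B] [NormedAlgebra ℂ B] [StarModule ℂ B]
  [CompleteSpace B]

namespace IsFiniteRangeApprox

variable {X : ℕ → B} {S : ℕ → Submodule ℂ B} {D : B → B} {r : ℕ} {C : ℝ}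
  (h : IsFiniteRangeApprox X S D r C)

include h

theorem norm_innerFlow_sub_time (L : ℕ) (s t : ℝ) (x : B) :
    ‖innerFlow (X L) t x - innerFlow (X L) s x‖ ≤ ‖innerDerivation (X L) x‖ * ‖t - s‖ :=
  Convex.norm_image_sub_le_of_norm_hasDerivWithin_le (s := Set.univ)
    (fun u _ => (hasDerivAt_innerFlow (X L) u x).hasDerivWithinAt)
    (fun u _ => (norm_innerFlow (h.skew L) u _).le) convex_univ trivial trivial

theorem eventually_eq {N : ℕ} {A : B} (hA : A ∈ S N) :
    ∀ᶠ L in atTop, innerDerivation (X L) A = D A :=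
  (eventually_ge_atTop (N + r)).mono fun L hL => h.eq L N A hA hL

/-- The Lipschitz constant ‖D A‖ of the inner flows no longer depends on L once L is large, so it
survives the limit. -/
theorem continuous_limitFlow_of_mem {N : ℕ} {A : B} (hA : A ∈ S N) :
    Continuous (fun t => h.limitFlow t A) := by
  have hle : ∀ s t, ‖h.limitFlow t A - h.limitFlow s A‖ ≤ ‖D A‖ * ‖t - s‖ := fun s t =>
    le_of_tendsto ((h.tendsto_limitFlow t A).sub (h.tendsto_limitFlow s A)).norm
      ((h.eventually_eq hA).mono fun L hL => hL ▸ h.norm_innerFlow_sub_time L s t A)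
  refine (LipschitzWith.of_dist_le_mul (K := ⟨‖D A‖, norm_nonneg _⟩) fun s t => ?_).continuous
  rw [dist_eq_norm, dist_eq_norm]
  exact hle t s

theorem continuous_limitFlow (x : B) : Continuous (fun t => h.limitFlow t x) := by
  refine continuous_of_uniform_approx_of_continuous fun u hu => ?_
  obtain ⟨ε, hε, hu⟩ := Metric.mem_uniformity_dist.1 hu
  obtain ⟨N, A, hA, hx⟩ := h.exists_local_near x hε
  refine ⟨_, h.continuous_limitFlow_of_mem hA, fun t => hu ?_⟩
  rwa [dist_eq_norm, ← h.limitFlow_sub, h.norm_limitFlow]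

theorem hasDerivAt_limitFlow {x y : B} (hx : HasDerivAt (fun t => h.limitFlow t x) y 0) (t : ℝ) :
    HasDerivAt (fun s => h.limitFlow s x) (h.limitFlow t y) t := by
  have h1 : HasDerivAt (fun s => h.limitFlow (s - t) x) y t := by
    have : HasDerivAt (fun s => h.limitFlow s x) y (t - t) := by rwa [sub_self]
    exact this.comp_sub_const t t
  have h2 := ((h.limitClm t).restrictScalars ℝ).hasFDerivAt.comp_hasDerivAt t h1
  refine h2.congr_of_eventuallyEq (Eventually.of_forall fun s => ?_)
  change _ = h.limitFlow t (h.limitFlow (s - t) x)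
  rw [← h.limitFlow_add_time, add_sub_cancel]

/-- Unlike the derivative, the integral equation is visibly a closed condition on (x, y), and it can
be obtained as a limit of the equations for inner flows. -/
theorem hasDerivAt_limitFlow_iff (x y : B) :
    HasDerivAt (fun t => h.limitFlow t x) y 0 ↔
      ∀ t, h.limitFlow t x - x = ∫ s in (0 : ℝ)..t, h.limitFlow s y := by
  constructor
  · intro hx t
    rw [intervalIntegral.integral_eq_sub_of_hasDerivAt
      (fun s _ => h.hasDerivAt_limitFlow hx s)
      ((h.continuous_limitFlow y).intervalIntegrable _ _), h.limitFlow_zero]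
  · intro hx
    have hd := ((h.continuous_limitFlow y).integral_hasStrictDerivAt 0 0).hasDerivAt.add_const x
    rw [h.limitFlow_zero] at hd
    refine hd.congr_of_eventuallyEq (Eventually.of_forall fun s => ?_)
    change _ = (∫ u in (0 : ℝ)..s, h.limitFlow u y) + x
    rw [← hx s, sub_add_cancel]

theorem continuous_integral_limitFlow (t : ℝ) :
    Continuous (fun x => ∫ s in (0 : ℝ)..t, h.limitFlow s x) := by
  refine (LipschitzWith.of_dist_le_mul (K := ⟨|t - 0|, abs_nonneg _⟩) fun x y => ?_).continuous
  rw [dist_eq_norm, dist_eq_norm, ← intervalIntegral.integral_sub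
    ((h.continuous_limitFlow x).intervalIntegrable _ _)
    ((h.continuous_limitFlow y).intervalIntegrable _ _)]
  refine (intervalIntegral.norm_integral_le_of_norm_le_const (C := ‖x - y‖) fun s _ => ?_).trans
    (mul_comm _ _).le
  rw [← h.limitFlow_sub, h.norm_limitFlow]

theorem isClosed_generator :
    IsClosed {p : B × B | HasDerivAt (fun t => h.limitFlow t p.1) p.2 0} := by
  simp_rw [h.hasDerivAt_limitFlow_iff, Set.ofPred_forall]
  refine isClosed_iInter fun t => isClosed_eq ?_ ?_
  · exact ((h.limitClm t).continuous.comp continuous_fst).sub continuous_fst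
  · exact (h.continuous_integral_limitFlow t).comp continuous_snd

theorem hasDerivAt_limitFlow_of_mem {N : ℕ} {A : B} (hA : A ∈ S N) :
    HasDerivAt (fun t => h.limitFlow t A) (D A) 0 := by
  rw [h.hasDerivAt_limitFlow_iff]
  intro t
  have h1 : Tendsto (fun L => ∫ s in (0 : ℝ)..t, innerFlow (X L) s (D A)) atTop
      (𝓝 (∫ s in (0 : ℝ)..t, h.limitFlow s (D A))) := by
    refine intervalIntegral.tendsto_integral_filter_of_dominated_convergence (fun _ => ‖D A‖)
      (Eventually.of_forall fun L => (continuous_innerFlow _ _).aestronglyMeasurable)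
      (Eventually.of_forall fun L => Eventually.of_forall fun s _ =>
        (norm_innerFlow (h.skew L) s _).le) (by simp)
      (Eventually.of_forall fun s _ => h.tendsto_limitFlow s _)
  have h2 : Tendsto (fun L => innerFlow (X L) t A - A) atTop (𝓝 (h.limitFlow t A - A)) :=
    (h.tendsto_limitFlow t A).sub_const A
  refine tendsto_nhds_unique h2 (h1.congr' ((h.eventually_eq hA).mono fun L hL => ?_))
  rw [← hL, intervalIntegral.integral_eq_sub_of_hasDerivAt
      (fun s _ => hasDerivAt_innerFlow (X L) s A)
      ((continuous_innerFlow _ _).intervalIntegrable _ _), innerFlow_zero]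

omit h in
/-- The graph of the restriction of `D` to the union of the `S N`. -/
def localGraph (h : IsFiniteRangeApprox X S D r C) : Submodule ℂ (B × B) where
  carrier := {p | p.1 ∈ (⋃ N, (S N : Set B)) ∧ p.2 = D p.1}
  zero_mem' := by
    refine ⟨Set.mem_iUnion.2 ⟨0, (S 0).zero_mem⟩, ?_⟩
    simpa using h.eq _ 0 0 (S 0).zero_mem le_rfl
  add_mem' := by
    rintro ⟨x, x'⟩ ⟨y, y'⟩ ⟨hx, hx' : x' = D x⟩ ⟨hy, hy' : y' = D y⟩
    subst hx' hy'
    obtain ⟨N, hN⟩ := Set.mem_iUnion.1 hx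
    obtain ⟨M, hM⟩ := Set.mem_iUnion.1 hy
    have hx' := h.mono (le_max_left N M) hN
    have hy' := h.mono (le_max_right N M) hM
    have hxy := (S (max N M)).add_mem hx' hy'
    refine ⟨Set.mem_iUnion.2 ⟨_, hxy⟩, ?_⟩
    change D x + D y = D (x + y)
    rw [← h.eq _ _ _ hx' le_rfl, ← h.eq _ _ _ hy' le_rfl, ← h.eq _ _ _ hxy le_rfl, map_add]
  smul_mem' := by
    rintro c ⟨x, x'⟩ ⟨hx, hx' : x' = D x⟩
    subst hx'
    obtain ⟨N, hN⟩ := Set.mem_iUnion.1 hx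
    have hc := (S N).smul_mem c hN
    refine ⟨Set.mem_iUnion.2 ⟨N, hc⟩, ?_⟩
    change c • D x = D (c • x)
    rw [← h.eq _ _ _ hN le_rfl, ← h.eq _ _ _ hc le_rfl, map_smul]

/-- The partial sums of the exponential series of A and of D A, taken as pairs, lie in the local
graph. Hence the flow for short times keeps that graph inside its closure. -/
theorem limitFlow_mem_graph_closure {N : ℕ} {A : B} (hA : A ∈ S N) {t : ℝ}
    (ht : 2 * C * r * |t| < 1) :
    (h.limitFlow t A, h.limitFlow t (D A)) ∈ h.localGraph.topologicalClosure := by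
  have hDA : D A ∈ S (N + r) := h.eq _ N A hA le_rfl ▸ h.mem _ N A hA
  have h1 := (h.summable_series hA ht).hasSum
  have h2 := (h.summable_series hDA ht).hasSum
  rw [← h.limitFlow_eq_tsum hA ht] at h1
  rw [← h.limitFlow_eq_tsum hDA ht] at h2
  refine h.localGraph.isClosed_topologicalClosure.mem_of_tendsto (h1.prodMk h2).tendsto_sum_nat
    (Eventually.of_forall fun M => Submodule.sum_mem _ fun n _ => ?_)
  refine Submodule.smul_mem _ ((t : ℂ) ^ n / n.factorial)
    (h.localGraph.le_topologicalClosure (x := (D^[n] A, D^[n] (D A))) ?_)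
  refine ⟨Set.mem_iUnion.2 ⟨_, h.iterate_mem n N hA⟩, ?_⟩
  rw [← Function.iterate_succ_apply, Function.iterate_succ_apply']

/-- For local A the pair is the integral of (α_s A, α_s D A), which stays in the closed graph. Both
components are continuous in x, so density gives all x, whether or not x is in the domain of the
generator. -/
theorem integral_mem_graph_closure {ε : ℝ} (hε : 0 < ε) (hsmall : 2 * C * r * ε < 1) (x : B) :
    (∫ s in (0 : ℝ)..ε, h.limitFlow s x, h.limitFlow ε x - x) ∈
      h.localGraph.topologicalClosure := by
  have hclosed : IsClosed {x : B | (∫ s in (0 : ℝ)..ε, h.limitFlow s x, h.limitFlow ε x - x) ∈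
      (h.localGraph.topologicalClosure : Set (B × B))} :=
    h.localGraph.isClosed_topologicalClosure.preimage
      ((h.continuous_integral_limitFlow ε).prodMk
        ((h.limitClm ε).continuous.sub continuous_id))
  refine hclosed.closure_subset_iff.2 (fun A hA => ?_) (h.dense x)
  obtain ⟨N, hN⟩ := Set.mem_iUnion.1 hA
  have hc1 := h.continuous_limitFlow A
  have hc2 := h.continuous_limitFlow (D A)
  have hint := intervalIntegral_mem_of_isClosed
    (h.localGraph.topologicalClosure.restrictScalars ℝ)
    h.localGraph.isClosed_topologicalClosure
    (f := fun s => (h.limitFlow s A, h.limitFlow s (D A))) (hc1.prodMk hc2) hε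
    (fun s hs => h.limitFlow_mem_graph_closure hN (by
      have hC := h.pos
      rw [abs_of_pos hs.1]
      refine lt_of_le_of_lt ?_ hsmall
      exact mul_le_mul_of_nonneg_left hs.2 (by positivity)))
  rw [intervalIntegral.integral_of_le hε.le, integral_pair hc1.integrableOn_Ioc
    hc2.integrableOn_Ioc, ← intervalIntegral.integral_of_le hε.le,
    ← intervalIntegral.integral_of_le hε.le,
    ← (h.hasDerivAt_limitFlow_iff A (D A)).1 (h.hasDerivAt_limitFlow_of_mem hN) ε] at hint
  exact hint

/-- Dividing the previous pair by ε and letting ε tend to 0 from the right produces (x, y). -/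
theorem mem_graph_closure_of_hasDerivAt {x y : B}
    (hx : HasDerivAt (fun t => h.limitFlow t x) y 0) :
    (x, y) ∈ h.localGraph.topologicalClosure := by
  have hC := h.pos
  have h1 := hx.tendsto_slope_zero_right
  have h2 := ((h.continuous_limitFlow x).integral_hasStrictDerivAt 0 0).hasDerivAt
    |>.tendsto_slope_zero_right
  simp only [zero_add, h.limitFlow_zero, intervalIntegral.integral_same, sub_zero] at h1 h2
  refine h.localGraph.isClosed_topologicalClosure.mem_of_tendsto (h2.prodMk_nhds h1) ?_
  have hr : (0 : ℝ) < r := by exact_mod_cast h.one_le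
  have hlt : ∀ᶠ ε : ℝ in 𝓝[>] 0, ε < 1 / (2 * C * r) :=
    nhdsWithin_le_nhds (gt_mem_nhds (by positivity))
  filter_upwards [self_mem_nhdsWithin, hlt] with ε hε hε'
  rw [lt_div_iff₀' (by positivity)] at hε'
  exact (h.localGraph.topologicalClosure.restrictScalars ℝ).smul_mem ε⁻¹
    (h.integral_mem_graph_closure hε hε' x)

theorem generator_limitFlow :
    {p : B × B | HasDerivAt (fun t : ℝ => h.limitFlow t p.1) p.2 0} =
      closure {p : B × B | p.1 ∈ (⋃ N, (S N : Set B)) ∧ p.2 = D p.1} := by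
  refine Set.Subset.antisymm (fun p hp => h.mem_graph_closure_of_hasDerivAt hp)
    (closure_minimal ?_ h.isClosed_generator)
  rintro ⟨x, y⟩ ⟨hx, hy⟩
  obtain ⟨N, hN⟩ := Set.mem_iUnion.1 hx
  have := h.hasDerivAt_limitFlow_of_mem hN
  simp only at hy
  subst hy
  exact this

end IsFiniteRangeApprox

end

end Nicolai

namespace Nicolai

noncomputable section

/-! ### Locality in the CAR algebra -/

instance : CompleteSpace CAR :=
  (StarSubalgebra.isClosed_topologicalClosure (StarAlgebra.adjoin ℂ
    (Set.range annihilation))).isComplete.completeSpace_coe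

theorem a_anticomm (i j : ℤ) : a i * a j = -(a j * a i) :=
  Subtype.ext (eq_neg_of_add_eq_zero_left (annihilation_anticomm i j))

theorem star_a_anticomm {i j : ℤ} (h : i ≠ j) : star (a i) * a j = -(a j * star (a i)) := by
  refine Subtype.ext (eq_neg_of_add_eq_zero_left ?_)
  have := creation_annihilation i j
  rwa [if_neg h] at this

theorem zeta_anticomm {i j : ℤ} (h : i ≠ j) (s t : ℤˣ) :
    zeta i s * zeta j t = -(zeta j t * zeta i s) := by
  unfold zeta
  split_ifs
  · simpa using congrArg star (a_anticomm j i)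
  · exact star_a_anticomm h
  · rw [star_a_anticomm h.symm, neg_neg]
  · exact a_anticomm i j

theorem zeta_mul_self (i : ℤ) (s : ℤˣ) : zeta i s * zeta i s = 0 := by
  have h : a i * a i = 0 := by
    have h2 : (2 : ℂ) • (a i * a i) = 0 := by
      rw [two_smul, ← sub_neg_eq_add, ← a_anticomm, sub_self]
    exact (smul_eq_zero.1 h2).resolve_left two_ne_zero
  unfold zeta
  split_ifs
  · rw [← star_mul, h, star_zero]
  · exact h

theorem norm_weighted_le (e : Finset ℤ → Finset ℤ) (c : Finset ℤ → ℂ)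
    (hc : ∀ S, ‖c S‖ ≤ 1) (he : Set.InjOn e {S | c S ≠ 0}) : ‖weighted e c hc he‖ ≤ 1 := by
  unfold weighted
  exact LinearMap.mkContinuous_norm_le _ zero_le_one _

theorem norm_a_le (i : ℤ) : ‖a i‖ ≤ 1 := by
  change ‖annihilation i‖ ≤ 1
  unfold annihilation
  exact norm_weighted_le _ _ _ _

theorem norm_zeta_le (i : ℤ) (s : ℤˣ) : ‖zeta i s‖ ≤ 1 := by
  unfold zeta
  split_ifs
  · exact (norm_star (a i)).trans_le (norm_a_le i)
  · exact norm_a_le i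

theorem grading_mul (x y : CAR) : grading (x * y) = grading x * grading y := by
  refine Subtype.ext ?_
  change parity * (x.1 * y.1) * parity = (parity * x.1 * parity) * (parity * y.1 * parity)
  calc _ = parity * x.1 * 1 * y.1 * parity := by noncomm_ring
    _ = _ := by
      rw [← parity_mul_parity]
      noncomm_ring

theorem grading_add (x y : CAR) : grading (x + y) = grading x + grading y := by
  refine Subtype.ext ?_
  change parity * (x.1 + y.1) * parity = parity * x.1 * parity + parity * y.1 * parity
  noncomm_ring

theorem grading_neg (x : CAR) : grading (-x) = -grading x := by
  refine Subtype.ext ?_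
  change parity * (-x.1) * parity = -(parity * x.1 * parity)
  noncomm_ring

theorem grading_sub (x y : CAR) : grading (x - y) = grading x - grading y := by
  rw [sub_eq_add_neg, grading_add, grading_neg, sub_eq_add_neg]

theorem grading_star (x : CAR) : grading (star x) = star (grading x) := by
  refine Subtype.ext ?_
  change parity * star x.1 * parity = star (parity * x.1 * parity)
  simp [star_mul, star_parity, mul_assoc]

theorem grading_algebraMap (z : ℂ) : grading (algebraMap ℂ CAR z) = algebraMap ℂ CAR z := by
  refine Subtype.ext ?_
  change parity * algebraMap ℂ FockOp z * parity = algebraMap ℂ FockOp z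
  rw [← Algebra.commutes, mul_assoc, parity_mul_parity, mul_one]

theorem grading_zero : grading 0 = 0 := by
  simpa using grading_algebraMap 0

theorem grading_grading (x : CAR) : grading (grading x) = x := by
  refine Subtype.ext ?_
  change parity * (parity * x.1 * parity) * parity = x.1
  calc _ = (parity * parity) * x.1 * (parity * parity) := by noncomm_ring
    _ = _ := by rw [parity_mul_parity, one_mul, mul_one]

theorem grading_zeta (i : ℤ) (s : ℤˣ) : grading (zeta i s) = -zeta i s := by
  unfold zeta
  split_ifs
  · rw [grading_star, grading_a, star_neg]
  · exact grading_a i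

theorem grading_sum {ι : Type*} (F : Finset ι) (g : ι → CAR) :
    grading (∑ i ∈ F, g i) = ∑ i ∈ F, grading (g i) :=
  map_sum (⟨⟨grading, grading_zero⟩, grading_add⟩ : CAR →+ CAR) g F

theorem localAlgebra_mono {I J : Finset ℤ} (h : I ⊆ J) : localAlgebra I ≤ localAlgebra J :=
  StarAlgebra.adjoin_mono (Set.image_mono (Finset.coe_subset.2 h))

theorem a_mem_localAlgebra {I : Finset ℤ} {i : ℤ} (h : i ∈ I) : a i ∈ localAlgebra I :=
  StarAlgebra.subset_adjoin ℂ _ ⟨i, h, rfl⟩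

theorem zeta_mem_localAlgebra {I : Finset ℤ} {i : ℤ} (h : i ∈ I) (s : ℤˣ) :
    zeta i s ∈ localAlgebra I := by
  unfold zeta
  split_ifs
  · exact star_mem (a_mem_localAlgebra h)
  · exact a_mem_localAlgebra h

theorem grading_mem_localAlgebra {I : Finset ℤ} {x : CAR} (hx : x ∈ localAlgebra I) :
    grading x ∈ localAlgebra I := by
  unfold localAlgebra at hx
  induction hx using StarAlgebra.adjoin_induction with
  | mem x hx =>
    obtain ⟨i, hi, rfl⟩ := hx
    rw [grading_a]
    exact neg_mem (a_mem_localAlgebra hi)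
  | algebraMap z =>
    rw [grading_algebraMap]
    exact algebraMap_mem _ z
  | add x y _ _ hx hy =>
    rw [grading_add]
    exact add_mem hx hy
  | mul x y _ _ hx hy =>
    rw [grading_mul]
    exact mul_mem hx hy
  | star x _ hx =>
    rw [grading_star]
    exact star_mem hx

/-- An element anticommuting with the generators of `𝒜(I)` graded-commutes with `𝒜(I)`. -/
theorem mul_eq_grading_mul {I : Finset ℤ} {y : CAR}
    (hy : ∀ j ∈ I, ∀ s, y * zeta j s = -(zeta j s * y)) {x : CAR} (hx : x ∈ localAlgebra I) :
    y * x = grading x * y := by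
  -- The claim is carried for x and star x together, since otherwise the induction could not pass
  -- the adjoint.
  have key : y * x = grading x * y ∧ y * star x = grading (star x) * y := by
    unfold localAlgebra at hx
    induction hx using StarAlgebra.adjoin_induction with
    | mem x hx =>
      obtain ⟨i, hi, rfl⟩ := hx
      have h1 := hy i hi (-1)
      have h2 := hy i hi 1
      simp only [zeta, if_true, show ((-1 : ℤˣ) = 1) = False by decide, if_false] at h1 h2
      rw [grading_star, grading_a, star_neg, neg_mul, neg_mul]
      exact ⟨h1, h2⟩
    | algebraMap z =>
      rw [← algebraMap_star_comm, grading_algebraMap, grading_algebraMap]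
      exact ⟨(Algebra.commutes _ _).symm, (Algebra.commutes _ _).symm⟩
    | add x y _ _ hx hy =>
      rw [star_add, grading_add, grading_add, mul_add, mul_add, add_mul, add_mul, hx.1, hy.1, hx.2,
        hy.2]
      exact ⟨rfl, rfl⟩
    | mul x y _ _ hx hy =>
      rw [star_mul, grading_mul, grading_mul]
      constructor
      · rw [← mul_assoc, hx.1, mul_assoc, hy.1, mul_assoc]
      · rw [← mul_assoc, hy.2, mul_assoc, hx.2, mul_assoc]
    | star x _ hx =>
      rw [star_star]
      exact ⟨hx.2, hx.1⟩
  exact key.1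

/-! ### The supercharges -/

theorem zeta_one (i : ℤ) : zeta i 1 = star (a i) := if_pos rfl

theorem zeta_neg_one (i : ℤ) : zeta i (-1) = a i := if_neg (by decide)

/-- The supercharge `q i` or its adjoint, for the sign `-1` or `1` respectively. -/
def charge (s : ℤˣ) (i : ℤ) : CAR := if s = 1 then star (q i) else q i

theorem charge_one (i : ℤ) : charge 1 i = star (q i) := if_pos rfl

theorem charge_neg_one (i : ℤ) : charge (-1) i = q i := if_neg (by decide)

/-- Both supercharges are, up to a sign, the product of three fermion operators on neighbouring
sites. -/
theorem charge_eq (s : ℤˣ) (i : ℤ) :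
    charge s i = zeta (2 * i - 1) s * zeta (2 * i) (-s) * zeta (2 * i + 1) s ∨
      charge s i = -(zeta (2 * i - 1) s * zeta (2 * i) (-s) * zeta (2 * i + 1) s) := by
  rcases Int.units_eq_one_or s with rfl | rfl
  · left
    simp only [charge_one, zeta_one, zeta_neg_one, q, star_mul, star_star, mul_assoc]
  · right
    -- Reversing three anticommuting factors takes three transpositions, hence the minus sign.
    rw [neg_neg, charge_neg_one, q, ← zeta_one, ← zeta_neg_one, ← zeta_neg_one, mul_assoc,
      zeta_anticomm (i := 2 * i) (j := 2 * i - 1) (by omega), mul_neg, ← mul_assoc,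
      zeta_anticomm (i := 2 * i + 1) (j := 2 * i - 1) (by omega), neg_mul, mul_assoc,
      zeta_anticomm (i := 2 * i + 1) (j := 2 * i) (by omega), mul_neg, mul_assoc]
    simp

theorem star_charge (s : ℤˣ) (i : ℤ) : star (charge s i) = charge (-s) i := by
  rcases Int.units_eq_one_or s with rfl | rfl
  · rw [charge_one, star_star, charge_neg_one]
  · rw [charge_neg_one, neg_neg, charge_one]

theorem norm_charge_le (s : ℤˣ) (i : ℤ) : ‖charge s i‖ ≤ 1 := by
  have h : ‖zeta (2 * i - 1) s * zeta (2 * i) (-s) * zeta (2 * i + 1) s‖ ≤ 1 := by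
    refine (norm_mul_le _ _).trans (mul_le_one₀ ?_ (norm_nonneg _) (norm_zeta_le _ _))
    exact (norm_mul_le _ _).trans (mul_le_one₀ (norm_zeta_le _ _) (norm_nonneg _)
      (norm_zeta_le _ _))
  rcases charge_eq s i with h1 | h1 <;> rw [h1]
  · exact h
  · rwa [norm_neg]

theorem grading_charge (s : ℤˣ) (i : ℤ) : grading (charge s i) = -charge s i := by
  rcases charge_eq s i with h | h <;> rw [h] <;>
    simp only [grading_neg, grading_mul, grading_zeta] <;> noncomm_ring

theorem charge_mem_localAlgebra {I : Finset ℤ} {i : ℤ} (s : ℤˣ) (h1 : 2 * i - 1 ∈ I)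
    (h2 : 2 * i ∈ I) (h3 : 2 * i + 1 ∈ I) : charge s i ∈ localAlgebra I := by
  have h : zeta (2 * i - 1) s * zeta (2 * i) (-s) * zeta (2 * i + 1) s ∈ localAlgebra I :=
    mul_mem (mul_mem (zeta_mem_localAlgebra h1 _) (zeta_mem_localAlgebra h2 _))
      (zeta_mem_localAlgebra h3 _)
  rcases charge_eq s i with h1 | h1 <;> rw [h1]
  · exact h
  · exact neg_mem h

theorem triple_mul_anticomm {R : Type*} [Ring R] {x y z w : R} (hx : x * w = -(w * x))
    (hy : y * w = -(w * y)) (hz : z * w = -(w * z)) : x * y * z * w = -(w * (x * y * z)) := by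
  rw [mul_assoc, hz, mul_neg, ← mul_assoc, mul_assoc x, hy, mul_neg, ← mul_assoc, hx]
  noncomm_ring

theorem charge_anticomm_zeta {i j : ℤ} (h1 : 2 * i - 1 ≠ j) (h2 : 2 * i ≠ j) (h3 : 2 * i + 1 ≠ j)
    (s t : ℤˣ) : charge s i * zeta j t = -(zeta j t * charge s i) := by
  have h := triple_mul_anticomm (zeta_anticomm h1 s t) (zeta_anticomm h2 (-s) t)
    (zeta_anticomm h3 s t)
  rcases charge_eq s i with h' | h' <;> rw [h']
  · exact h
  · rw [neg_mul, h, mul_neg]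

theorem oddCommutator_charge_eq_zero {I : Finset ℤ} {i : ℤ} (s : ℤˣ) (h1 : 2 * i - 1 ∉ I)
    (h2 : 2 * i ∉ I) (h3 : 2 * i + 1 ∉ I) {x : CAR} (hx : x ∈ localAlgebra I) :
    oddCommutator (charge s i) x = 0 :=
  sub_eq_zero.2 (mul_eq_grading_mul (fun j hj t => charge_anticomm_zeta
    (by rintro rfl; exact h1 hj) (by rintro rfl; exact h2 hj) (by rintro rfl; exact h3 hj) s t) hx)

/-- Neighbouring supercharges share one site; from index distance two on the supports are disjoint,
and odd elements with disjoint supports anticommute. -/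
theorem charge_anticomm_charge {i j : ℤ} (h : i + 2 ≤ j ∨ j + 2 ≤ i) (s t : ℤˣ) :
    charge s i * charge t j = -(charge t j * charge s i) := by
  have hj : charge t j ∈ localAlgebra {2 * j - 1, 2 * j, 2 * j + 1} :=
    charge_mem_localAlgebra t (by simp) (by simp) (by simp)
  have h0 := oddCommutator_charge_eq_zero (i := i) s (by simp; omega) (by simp; omega)
    (by simp; omega) hj
  rw [oddCommutator, grading_charge, neg_mul] at h0
  exact sub_eq_zero.1 h0

/-- The odd derivations `δ` and `δ*`, for the sign `-1` or `1` respectively. -/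
def superderivation (s : ℤˣ) (x : CAR) : CAR := ∑ᶠ i : ℤ, oddCommutator (charge s i) x

theorem delta_eq (x : CAR) : delta x = superderivation (-1) x := by
  simp only [delta, superderivation, charge_neg_one]

theorem deltaStar_eq (x : CAR) : deltaStar x = superderivation 1 x := by
  simp only [deltaStar, superderivation, charge_one]

end

end Nicolai

namespace Nicolai

noncomputable section

/-! ### The Nicolai Hamiltonians of finite volumes -/

/-- The interval `[-2N-1, 2N+1]`, the support of the supercharges `q i` with `|i| ≤ N`. -/
def box (N : ℕ) : Finset ℤ := Finset.Icc (-2 * N - 1) (2 * N + 1)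

theorem mem_box {N : ℕ} {j : ℤ} : j ∈ box N ↔ -2 * (N : ℤ) - 1 ≤ j ∧ j ≤ 2 * N + 1 :=
  Finset.mem_Icc

/-- The algebra of `box N` as a subspace of `𝒜`. -/
def boxSubspace (N : ℕ) : Submodule ℂ CAR :=
  Subalgebra.toSubmodule (localAlgebra (box N)).toSubalgebra

theorem box_mono {N M : ℕ} (h : N ≤ M) : box N ⊆ box M := fun j hj => by
  rw [mem_box] at hj ⊢
  omega

theorem boxSubspace_mono : Monotone boxSubspace := fun _ _ h _ hx =>
  localAlgebra_mono (box_mono h) hx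

theorem exists_subset_box (I : Finset ℤ) : ∃ N, I ⊆ box N := by
  refine ⟨I.sup Int.natAbs, fun j hj => ?_⟩
  have := Finset.le_sup (f := Int.natAbs) hj
  rw [mem_box]
  omega

theorem localElements_eq : localElements = ⋃ N, (boxSubspace N : Set CAR) := by
  refine Set.Subset.antisymm (Set.iUnion_subset fun I x hx => ?_)
    (Set.iUnion_subset fun N x hx => Set.mem_iUnion.2 ⟨box N, hx⟩)
  obtain ⟨N, hN⟩ := exists_subset_box I
  exact Set.mem_iUnion.2 ⟨N, localAlgebra_mono hN hx⟩

theorem dense_boxSubspace : Dense (⋃ N, (boxSubspace N : Set CAR)) := by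
  intro x
  have key : ∀ y ∈ StarAlgebra.adjoin ℂ (Set.range annihilation),
      ∃ N, ∃ z ∈ boxSubspace N, z.1 = y := by
    intro y hy
    induction hy using StarAlgebra.adjoin_induction with
    | mem y hy =>
      obtain ⟨i, rfl⟩ := hy
      obtain ⟨N, hN⟩ := exists_subset_box {i}
      exact ⟨N, a i, a_mem_localAlgebra (hN (by simp)), rfl⟩
    | algebraMap z => exact ⟨0, algebraMap ℂ CAR z, algebraMap_mem (localAlgebra (box 0)) z, rfl⟩
    | add y z _ _ hy hz =>
      obtain ⟨N, y, hy, rfl⟩ := hy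
      obtain ⟨M, z, hz, rfl⟩ := hz
      exact ⟨max N M, y + z, add_mem (boxSubspace_mono (le_max_left _ _) hy)
        (boxSubspace_mono (le_max_right _ _) hz), rfl⟩
    | mul y z _ _ hy hz =>
      obtain ⟨N, y, hy, rfl⟩ := hy
      obtain ⟨M, z, hz, rfl⟩ := hz
      exact ⟨max N M, y * z, mul_mem (S := StarSubalgebra ℂ CAR)
        (boxSubspace_mono (le_max_left _ _) hy) (boxSubspace_mono (le_max_right _ _) hz), rfl⟩
    | star y _ hy =>
      obtain ⟨N, y, hy, rfl⟩ := hy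
      exact ⟨N, star y, show star y ∈ localAlgebra (box N) from star_mem hy, rfl⟩
  refine Metric.mem_closure_iff.2 fun ε hε => ?_
  obtain ⟨b, hb, hd⟩ := Metric.mem_closure_iff.1 (show x.1 ∈ closure _ from x.2) ε hε
  obtain ⟨N, z, hz, rfl⟩ := key b hb
  exact ⟨z, Set.mem_iUnion.2 ⟨N, hz⟩, hd⟩

theorem charge_mem_boxSubspace (s : ℤˣ) {i : ℤ} {N : ℕ} (h : |i| ≤ N) :
    charge s i ∈ boxSubspace N := by
  rw [abs_le] at h
  refine charge_mem_localAlgebra s ?_ ?_ ?_ <;> rw [mem_box] <;> omega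

/-- The threshold is N + 2 because the supercharge of index N + 1 still touches the boundary site 2N
+ 1 of `box N`. -/
theorem oddCommutator_charge_box (s : ℤˣ) {i : ℤ} {N : ℕ} (h : (N : ℤ) + 2 ≤ |i|) {x : CAR}
    (hx : x ∈ boxSubspace N) : oddCommutator (charge s i) x = 0 := by
  rw [le_abs] at h
  refine oddCommutator_charge_eq_zero s ?_ ?_ ?_ hx <;> rw [mem_box] <;> omega

theorem charge_mul_of_mem (s : ℤˣ) {i : ℤ} {N : ℕ} (h : (N : ℤ) + 2 ≤ |i|) {x : CAR}
    (hx : x ∈ boxSubspace N) : charge s i * x = grading x * charge s i :=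
  sub_eq_zero.1 (oddCommutator_charge_box s h hx)

theorem grading_mem_boxSubspace {N : ℕ} {x : CAR} (hx : x ∈ boxSubspace N) :
    grading x ∈ boxSubspace N :=
  grading_mem_localAlgebra hx

/-- The supercharge of the finite volume `[-2L-1, 2L+1]`, or its adjoint. -/
def boxCharge (s : ℤˣ) (L : ℕ) : CAR := ∑ i ∈ Finset.Icc (-L : ℤ) L, charge s i

theorem star_boxCharge (s : ℤˣ) (L : ℕ) : star (boxCharge s L) = boxCharge (-s) L := by
  simp only [boxCharge, star_sum, star_charge]

theorem grading_boxCharge (s : ℤˣ) (L : ℕ) : grading (boxCharge s L) = -boxCharge s L := by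
  simp only [boxCharge, grading_sum, grading_charge, Finset.sum_neg_distrib]

theorem superderivation_eq (s : ℤˣ) {N L : ℕ} (h : N + 1 ≤ L) {x : CAR}
    (hx : x ∈ boxSubspace N) : superderivation s x = oddCommutator (boxCharge s L) x := by
  have hsupp : (Function.support fun i : ℤ => oddCommutator (charge s i) x) ⊆
      (Finset.Icc (-L : ℤ) L : Set ℤ) := by
    intro i hi
    by_contra hc
    refine hi (oddCommutator_charge_box s ?_ hx)
    rw [Finset.mem_coe, Finset.mem_Icc, ← abs_le] at hc
    omega
  rw [superderivation, finsum_eq_sum_of_support_subset _ hsupp]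
  simp only [oddCommutator, boxCharge, Finset.sum_sub_distrib, Finset.sum_mul, Finset.mul_sum]

theorem boxCharge_mem (s : ℤˣ) (L : ℕ) : boxCharge s L ∈ boxSubspace L :=
  sum_mem fun _ hi => charge_mem_boxSubspace s (abs_le.2 (Finset.mem_Icc.1 hi))

theorem mul_mem_boxSubspace {N : ℕ} {x y : CAR} (hx : x ∈ boxSubspace N) (hy : y ∈ boxSubspace N) :
    x * y ∈ boxSubspace N :=
  mul_mem (S := StarSubalgebra ℂ CAR) hx hy

theorem superderivation_mem (s : ℤˣ) {N : ℕ} {x : CAR} (hx : x ∈ boxSubspace N) :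
    superderivation s x ∈ boxSubspace (N + 1) := by
  have hx' := boxSubspace_mono N.le_succ hx
  rw [superderivation_eq s le_rfl hx]
  exact sub_mem (mul_mem_boxSubspace (boxCharge_mem s _) hx')
    (mul_mem_boxSubspace (grading_mem_boxSubspace hx') (boxCharge_mem s _))

/-- The finite-volume Hamiltonian `Q* Q + Q Q*`. -/
def boxHamiltonian (L : ℕ) : CAR :=
  boxCharge 1 L * boxCharge (-1) L + boxCharge (-1) L * boxCharge 1 L

theorem star_boxHamiltonian (L : ℕ) : star (boxHamiltonian L) = boxHamiltonian L := by
  simp only [boxHamiltonian, star_add, star_mul, star_boxCharge, neg_neg]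

/-- Here p and q stand for odd elements and y for the grading of x. The mixed terms p y q and q y p
cancel, which is why two odd derivations combine into an ordinary commutator. -/
theorem graded_jacobi {R : Type*} [Ring R] (p q x y : R) :
    p * (q * x - y * q) - (-q * y - x * -q) * p + (q * (p * x - y * p) - (-p * y - x * -p) * q) =
      (p * q + q * p) * x - x * (p * q + q * p) := by
  noncomm_ring

/-- The first odd derivation enlarges the box by one and the second needs one more layer, hence N +
2. -/
theorem d_eq {N L : ℕ} (h : N + 2 ≤ L) {x : CAR} (hx : x ∈ boxSubspace N) :
    d x = boxHamiltonian L * x - x * boxHamiltonian L := by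
  rw [d, delta_eq, delta_eq, deltaStar_eq, deltaStar_eq,
    superderivation_eq _ (L := L) (by omega) (superderivation_mem _ hx),
    superderivation_eq _ (L := L) (by omega) (superderivation_mem _ hx),
    superderivation_eq _ (L := L) (by omega) hx, superderivation_eq _ (L := L) (by omega) hx]
  simp only [oddCommutator, grading_sub, grading_mul, grading_grading, grading_boxCharge,
    boxHamiltonian]
  exact graded_jacobi _ _ _ _

/-- The terms of the finite-volume Hamiltonians. -/
def interaction (i j : ℤ) : CAR :=
  charge 1 i * charge (-1) j + charge (-1) j * charge 1 i

theorem boxHamiltonian_eq_sum (L : ℕ) :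
    boxHamiltonian L =
      ∑ i ∈ Finset.Icc (-L : ℤ) L, ∑ j ∈ Finset.Icc (-L : ℤ) L, interaction i j := by
  simp only [boxHamiltonian, boxCharge, interaction, Finset.sum_add_distrib, Finset.sum_mul_sum]
  rw [Finset.sum_comm (f := fun i j => charge (-1) i * charge 1 j)]

theorem norm_interaction_le (i j : ℤ) : ‖interaction i j‖ ≤ 2 := by
  have h : ∀ s t i j, ‖charge s i * charge t j‖ ≤ 1 := fun s t i j =>
    (norm_mul_le _ _).trans (mul_le_one₀ (norm_charge_le _ _) (norm_nonneg _) (norm_charge_le _ _))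
  exact (norm_add_le _ _).trans (by linarith [h 1 (-1) i j, h (-1) 1 j i])

theorem interaction_eq_zero {i j : ℤ} (h : i + 2 ≤ j ∨ j + 2 ≤ i) : interaction i j = 0 := by
  rw [interaction, charge_anticomm_charge h, neg_add_cancel]

/-- Moving x past two odd factors applies the grading twice, that is, not at all. -/
theorem commutator_interaction_eq_zero {i j : ℤ} {N : ℕ} (hi : (N : ℤ) + 2 ≤ |i|)
    (hj : (N : ℤ) + 2 ≤ |j|) {x : CAR} (hx : x ∈ boxSubspace N) :
    innerDerivation (interaction i j) x = 0 := by
  have key : ∀ s t i j, (N : ℤ) + 2 ≤ |i| → (N : ℤ) + 2 ≤ |j| →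
      charge s i * charge t j * x = x * (charge s i * charge t j) := by
    intro s t i j hi hj
    rw [mul_assoc, charge_mul_of_mem t hj hx, ← mul_assoc,
      charge_mul_of_mem s hi (grading_mem_boxSubspace hx), grading_grading, mul_assoc]
  rw [innerDerivation_apply, interaction, add_mul, mul_add, key _ _ i j hi hj, key _ _ j i hj hi,
    sub_self]

/-- A surviving term has |i - j| ≤ 1 and at least one index of modulus at most N + 1, so both are at
most N + 2 in modulus. -/
theorem commutator_interaction_eq_zero' {i j : ℤ} {N : ℕ}
    (h : ¬(|i| ≤ (N : ℤ) + 2 ∧ |j| ≤ (N : ℤ) + 2 ∧ j ∈ Finset.Icc (i - 1) (i + 1))) {x : CAR}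
    (hx : x ∈ boxSubspace N) : innerDerivation (interaction i j) x = 0 := by
  by_cases hij : i + 2 ≤ j ∨ j + 2 ≤ i
  · rw [interaction_eq_zero hij, innerDerivation_apply, zero_mul, mul_zero, sub_zero]
  · rw [Finset.mem_Icc, abs_le, abs_le] at h
    refine commutator_interaction_eq_zero ?_ ?_ hx <;> rw [le_abs] <;> omega

theorem innerDerivation_boxHamiltonian (L : ℕ) (x : CAR) :
    innerDerivation (boxHamiltonian L) x =
      ∑ i ∈ Finset.Icc (-L : ℤ) L, ∑ j ∈ Finset.Icc (-L : ℤ) L,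
        innerDerivation (interaction i j) x := by
  simp only [boxHamiltonian_eq_sum, innerDerivation_apply, Finset.sum_mul, Finset.mul_sum,
    Finset.sum_sub_distrib]

theorem innerDerivation_boxHamiltonian_mem (L N : ℕ) {x : CAR} (hx : x ∈ boxSubspace N) :
    innerDerivation (boxHamiltonian L) x ∈ boxSubspace (N + 2) := by
  rw [innerDerivation_boxHamiltonian]
  refine sum_mem fun i _ => sum_mem fun j _ => ?_
  by_cases h : |i| ≤ (N : ℤ) + 2 ∧ |j| ≤ (N : ℤ) + 2 ∧ j ∈ Finset.Icc (i - 1) (i + 1)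
  · have hx' : x ∈ boxSubspace (N + 2) := boxSubspace_mono (by omega) hx
    have hi : ∀ s, charge s i ∈ boxSubspace (N + 2) := fun s =>
      charge_mem_boxSubspace s (by exact_mod_cast h.1)
    have hj : ∀ s, charge s j ∈ boxSubspace (N + 2) := fun s =>
      charge_mem_boxSubspace s (by exact_mod_cast h.2.1)
    have hint : interaction i j ∈ boxSubspace (N + 2) :=
      add_mem (mul_mem_boxSubspace (hi _) (hj _)) (mul_mem_boxSubspace (hj _) (hi _))
    exact sub_mem (mul_mem_boxSubspace hint hx') (mul_mem_boxSubspace hx' hint)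
  · rw [commutator_interaction_eq_zero' h hx]
    exact zero_mem _

theorem norm_innerDerivation_interaction_le (i j : ℤ) (x : CAR) :
    ‖innerDerivation (interaction i j) x‖ ≤ 4 * ‖x‖ := by
  have h := norm_interaction_le i j
  have h1 : ‖interaction i j * x‖ ≤ 2 * ‖x‖ := (norm_mul_le _ _).trans (by gcongr)
  have h2 : ‖x * interaction i j‖ ≤ ‖x‖ * 2 := (norm_mul_le _ _).trans (by gcongr)
  rw [innerDerivation_apply]
  exact (norm_sub_le _ _).trans (by linarith)

theorem sum_ite_le {ι : Type*} (F G : Finset ι) [DecidableEq ι] {c : ℝ} (hc : 0 ≤ c) :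
    ∑ i ∈ F, (if i ∈ G then c else 0) ≤ G.card * c := by
  rw [Finset.sum_ite_mem, Finset.sum_const, nsmul_eq_mul]
  gcongr
  exact Finset.inter_subset_right

theorem norm_innerDerivation_boxHamiltonian_le (L N : ℕ) {x : CAR} (hx : x ∈ boxSubspace N) :
    ‖innerDerivation (boxHamiltonian L) x‖ ≤ 60 * (N + 1) * ‖x‖ := by
  rw [innerDerivation_boxHamiltonian]
  -- Only the 2N + 5 rows with |i| ≤ N + 2 contribute, each with three neighbours and norm at most
  -- 4‖x‖ per term; 12 (2N + 5) ≤ 60 (N + 1).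
  have hrow : ∀ i, ‖∑ j ∈ Finset.Icc (-L : ℤ) L, innerDerivation (interaction i j) x‖ ≤
      if i ∈ Finset.Icc (-(N + 2) : ℤ) (N + 2) then 12 * ‖x‖ else 0 := by
    intro i
    refine (norm_sum_le _ _).trans ?_
    split_ifs with hi
    · calc _ ≤ ∑ j ∈ Finset.Icc (-L : ℤ) L,
            (if j ∈ Finset.Icc (i - 1) (i + 1) then 4 * ‖x‖ else 0) := by
            refine Finset.sum_le_sum fun j _ => ?_
            split_ifs with hj
            · exact norm_innerDerivation_interaction_le i j x
            · rw [commutator_interaction_eq_zero' (fun h => hj h.2.2) hx, norm_zero]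
        _ ≤ _ := sum_ite_le _ _ (by positivity)
        _ = _ := by
          rw [Int.card_Icc, show i + 1 + 1 - (i - 1) = 3 by ring, show Int.toNat 3 = 3 from rfl, Nat.cast_ofNat]
          ring
    · refine (Finset.sum_eq_zero fun j _ => ?_).le
      rw [commutator_interaction_eq_zero' (fun h => hi ?_) hx, norm_zero]
      rw [Finset.mem_Icc, ← abs_le]
      exact h.1
  calc _ ≤ _ := norm_sum_le_of_le _ fun i _ => hrow i
    _ ≤ _ := sum_ite_le _ _ (by positivity)
    _ ≤ _ := by
      rw [Int.card_Icc, show ((N : ℤ) + 2 + 1 - -(N + 2)) = ((2 * N + 5 : ℕ) : ℤ) by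
        push_cast; ring, Int.toNat_natCast]
      push_cast
      nlinarith [norm_nonneg x, mul_nonneg (Nat.cast_nonneg (α := ℝ) N) (norm_nonneg x)]

/-! ### Existence of the time evolution. -/

theorem innerDerivation_I_smul (X x : CAR) :
    innerDerivation (Complex.I • X) x = Complex.I • innerDerivation X x := by
  simp only [innerDerivation_apply, smul_mul_assoc, mul_smul_comm, smul_sub]

theorem isFiniteRangeApprox_boxHamiltonian :
    IsFiniteRangeApprox (fun L => Complex.I • boxHamiltonian L) boxSubspace
      (fun x => Complex.I • d x) 2 60 where
  skew L := by
    rw [star_smul, star_boxHamiltonian, ← neg_smul]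
    congr 1
    exact Complex.conj_I
  mono := boxSubspace_mono
  dense := dense_boxSubspace
  one_le := one_le_two
  pos := by norm_num
  mem L N x hx := by
    rw [innerDerivation_I_smul]
    exact Submodule.smul_mem _ _ (innerDerivation_boxHamiltonian_mem L N hx)
  bound L N x hx := by
    rw [innerDerivation_I_smul, norm_smul, Complex.norm_I, one_mul]
    exact norm_innerDerivation_boxHamiltonian_le L N hx
  eq L N x hx hL := by
    rw [innerDerivation_I_smul, d_eq hL hx, innerDerivation_apply]

/-- The time evolution exists. -/
theorem exists_isTimeEvolution : ∃ α : ℝ → (CAR ≃⋆ₐ[ℂ] CAR), IsTimeEvolution α := by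
  refine ⟨isFiniteRangeApprox_boxHamiltonian.limitAut, ?_⟩
  exact
    { zero := isFiniteRangeApprox_boxHamiltonian.limitFlow_zero
      add := isFiniteRangeApprox_boxHamiltonian.limitFlow_add_time
      continuous := isFiniteRangeApprox_boxHamiltonian.continuous_limitFlow
      generator := by
        rw [localElements_eq]
        exact isFiniteRangeApprox_boxHamiltonian.generator_limitFlow }

end

end Nicolai

namespace Nicolai

noncomputable section

/-! ### Monomials of sequences of conservation -/

/-- The factor z moves through the product, up to sign, until it meets a copy of itself, and z * z =
0. -/
theorem mul_prod_eq_zero_of_anticomm {R : Type*} [Ring R] {z : R} (hz : z * z = 0) {l : List R}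
    (hmem : z ∈ l) (hl : ∀ y ∈ l, y = z ∨ z * y = -(y * z)) :
    z * l.prod = 0 ∧ l.prod * z = 0 := by
  induction l with
  | nil => simp at hmem
  | cons y l ih =>
    have hl' : ∀ w ∈ l, w = z ∨ z * w = -(w * z) := fun w hw => hl w (List.mem_cons_of_mem _ hw)
    -- Needed when the only copy of z is the head of the list: multiplication on the right must then
    -- be carried across the whole tail.
    have hcomm : ∀ l' : List R, (∀ w ∈ l', w = z ∨ z * w = -(w * z)) →
        z * l'.prod * z = 0 := by
      intro l' h'
      induction l' with
      | nil => simpa using hz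
      | cons w l' ih' =>
        have hw := ih' fun v hv => h' v (List.mem_cons_of_mem _ hv)
        rcases h' w List.mem_cons_self with rfl | h1
        · rw [List.prod_cons, ← mul_assoc, hz, zero_mul, zero_mul]
        · rw [List.prod_cons, ← mul_assoc, h1, neg_mul, neg_mul, mul_assoc w, mul_assoc w, hw,
            mul_zero, neg_zero]
    rw [List.prod_cons]
    by_cases hzl : z ∈ l
    · obtain ⟨h1, h2⟩ := ih hzl hl'
      refine ⟨?_, by rw [mul_assoc, h2, mul_zero]⟩
      rcases hl y List.mem_cons_self with rfl | h3
      · rw [h1, mul_zero]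
      · rw [← mul_assoc, h3, neg_mul, mul_assoc, h1, mul_zero, neg_zero]
    · obtain rfl : z = y := (List.mem_cons.1 hmem).resolve_right hzl
      exact ⟨by rw [← mul_assoc, hz, zero_mul], hcomm l hl'⟩

theorem zeta_mul_monomialQ {k l : ℤ} (f : ℤ → ℤˣ) {j : ℤ} (h1 : 2 * k ≤ j) (h2 : j ≤ 2 * l) :
    zeta j (f j) * monomialQ k l f = 0 ∧ monomialQ k l f * zeta j (f j) = 0 := by
  refine mul_prod_eq_zero_of_anticomm (zeta_mul_self j (f j)) ?_ ?_
  · refine List.mem_map.2 ⟨(j - 2 * k).toNat, List.mem_range.2 (by omega), ?_⟩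
    rw [Int.toNat_of_nonneg (by omega), add_sub_cancel]
  · intro y hy
    obtain ⟨m, -, rfl⟩ := List.mem_map.1 hy
    by_cases hm : 2 * k + (m : ℤ) = j
    · left
      rw [hm]
    · right
      exact zeta_anticomm (Ne.symm hm) _ _

theorem monomialQ_mem_localAlgebra (k l : ℤ) (f : ℤ → ℤˣ) :
    monomialQ k l f ∈ localAlgebra (Finset.Icc (2 * k) (2 * l)) := by
  refine list_prod_mem fun y hy => ?_
  obtain ⟨m, hm, rfl⟩ := List.mem_map.1 hy
  rw [List.mem_range] at hm
  exact zeta_mem_localAlgebra (Finset.mem_Icc.2 ⟨by omega, by omega⟩) _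

/-- Up to sign, any of the three factors can be brought next to w on either side. -/
theorem triple_mul_eq_zero {R : Type*} [Ring R] {x y z w : R} (hxy : x * y = -(y * x))
    (hxz : x * z = -(z * x)) (hyz : y * z = -(z * y))
    (h : (x * w = 0 ∧ w * x = 0) ∨ (y * w = 0 ∧ w * y = 0) ∨ (z * w = 0 ∧ w * z = 0)) :
    x * y * z * w = 0 ∧ w * (x * y * z) = 0 := by
  rcases h with ⟨h1, h2⟩ | ⟨h1, h2⟩ | ⟨h1, h2⟩
  · constructor
    · calc x * y * z * w = y * z * (x * w) := by
            rw [hxy, neg_mul, mul_assoc y, hxz]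
            noncomm_ring
        _ = 0 := by rw [h1, mul_zero]
    · rw [← mul_assoc, ← mul_assoc, h2, zero_mul, zero_mul]
  · constructor
    · rw [mul_assoc x, hyz, mul_neg, neg_mul, mul_assoc, mul_assoc z, h1, mul_zero, mul_zero,
        neg_zero]
    · rw [hxy, neg_mul, mul_neg, ← mul_assoc, ← mul_assoc, h2, zero_mul, zero_mul, neg_zero]
  · constructor
    · rw [mul_assoc, h1, mul_zero]
    · calc w * (x * y * z) = (w * z) * (x * y) := by
            rw [mul_assoc x, hyz, mul_neg, ← mul_assoc, hxz]
            noncomm_ring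
        _ = 0 := by rw [h2, zero_mul]

/-- Every supercharge meeting the support of a sequence of conservation repeats one of the fermion
operators of the monomial. -/
theorem IsConservation.exists_match {k l : ℤ} {f : ℤ → ℤˣ} (h : IsConservation k l f) {i : ℤ}
    (hk : k ≤ i) (hl : i ≤ l) (s : ℤˣ) :
    (2 * k ≤ 2 * i - 1 ∧ f (2 * i - 1) = s) ∨ f (2 * i) = -s ∨
      (2 * i + 1 ≤ 2 * l ∧ f (2 * i + 1) = s) := by
  have hlt := h.lt
  have hunit : ∀ u : ℤˣ, u ≠ -s → u = s := by
    intro u hu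
    rcases Int.units_eq_one_or s with rfl | rfl <;> rcases Int.units_eq_one_or u with rfl | rfl <;>
      simp_all
  by_cases hm : f (2 * i) = -s
  · exact Or.inr (Or.inl hm)
  have hm' := hunit _ hm
  rcases hk.eq_or_lt with rfl | hk
  -- At the ends the supercharge sticks out of the support, so no pattern condition applies and the
  -- edge condition supplies the match.
  · exact Or.inr (Or.inr ⟨by omega, h.left_edge ▸ hm'⟩)
  rcases hl.eq_or_lt with rfl | hl
  · exact Or.inl ⟨by omega, h.right_edge.trans hm'⟩
  by_contra hc
  push Not at hc
  have h1 : f (2 * i - 1) = -s := by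
    have := hc.1 (by omega)
    rcases Int.units_eq_one_or s with rfl | rfl <;>
      rcases Int.units_eq_one_or (f (2 * i - 1)) with h | h <;> simp_all
  have h3 : f (2 * i + 1) = -s := by
    have := hc.2.2 (by omega)
    rcases Int.units_eq_one_or s with rfl | rfl <;>
      rcases Int.units_eq_one_or (f (2 * i + 1)) with h | h <;> simp_all
  -- Without a match the triple would read (-s, s, -s), one of the two forbidden patterns.
  obtain ⟨hp1, hp2⟩ := h.permitted i (by omega) (by omega)
  rcases Int.units_eq_one_or s with rfl | rfl
  · exact hp1 ⟨h1, hm', h3⟩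
  · exact hp2 ⟨h1, hm', h3⟩

theorem IsConservation.oddCommutator_eq_zero {k l : ℤ} {f : ℤ → ℤˣ} (h : IsConservation k l f)
    (s : ℤˣ) (i : ℤ) : oddCommutator (charge s i) (monomialQ k l f) = 0 := by
  by_cases hi : k ≤ i ∧ i ≤ l
  · obtain ⟨hk, hl⟩ := hi
    have hz : charge s i * monomialQ k l f = 0 ∧ monomialQ k l f * charge s i = 0 := by
      have h0 := triple_mul_eq_zero (w := monomialQ k l f)
        (zeta_anticomm (i := 2 * i - 1) (j := 2 * i) (by omega) s (-s))
        (zeta_anticomm (i := 2 * i - 1) (j := 2 * i + 1) (by omega) s s)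
        (zeta_anticomm (i := 2 * i) (j := 2 * i + 1) (by omega) (-s) s) (by
          rcases h.exists_match hk hl s with ⟨h1, h2⟩ | h2 | ⟨h1, h2⟩
          · exact Or.inl (h2 ▸ zeta_mul_monomialQ f h1 (by omega))
          · exact Or.inr (Or.inl (h2 ▸ zeta_mul_monomialQ f (by omega) (by omega)))
          · exact Or.inr (Or.inr (h2 ▸ zeta_mul_monomialQ f (by omega) h1)))
      rcases charge_eq s i with h' | h' <;> rw [h']
      · exact h0
      · rw [neg_mul, mul_neg, h0.1, h0.2, neg_zero]
        exact ⟨rfl, rfl⟩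
    -- The graded commutator contains the grading of the monomial; since the supercharge is odd,
    -- applying the grading to the vanishing product shows that this term vanishes too.
    have hg := congrArg grading hz.2
    rw [grading_mul, grading_charge, mul_neg, grading_zero, neg_eq_zero] at hg
    rw [oddCommutator, hz.1, hg, sub_zero]
  · refine oddCommutator_charge_eq_zero s ?_ ?_ ?_ (monomialQ_mem_localAlgebra k l f) <;>
      rw [Finset.mem_Icc] <;> omega

theorem IsConservation.d_eq_zero {k l : ℤ} {f : ℤ → ℤˣ} (h : IsConservation k l f) :
    d (monomialQ k l f) = 0 := by
  have h0 : ∀ s, superderivation s (monomialQ k l f) = 0 := fun s => by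
    simp only [superderivation, h.oddCommutator_eq_zero, finsum_zero]
  have h1 : ∀ s, superderivation s 0 = 0 := fun s => by
    simp only [superderivation, oddCommutator, grading_zero, mul_zero, zero_mul, sub_zero,
      finsum_zero]
  rw [d, delta_eq, delta_eq, deltaStar_eq, deltaStar_eq, h0, h0, h1, h1, add_zero]

/-! ### Constants of motion -/

/-- `IsTimeEvolution` does not require α t to be continuous on `CAR`; this is automatic, as
*-isomorphisms of C*-algebras are isometric. -/
theorem norm_map_starAut (φ : CAR ≃⋆ₐ[ℂ] CAR) (x : CAR) : ‖φ x‖ = ‖x‖ := by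
  let _ : CStarAlgebra CAR := StarSubalgebra.cstarAlgebra carAlgebra
    (h_closed := StarSubalgebra.isClosed_topologicalClosure _)
  exact StarAlgEquiv.norm_map φ x

/-- A `*`-automorphism of `𝒜` as a bounded operator. -/
def starAutClm (φ : CAR ≃⋆ₐ[ℂ] CAR) : CAR →L[ℂ] CAR :=
  LinearMap.mkContinuous { toFun := φ, map_add' := map_add φ, map_smul' := map_smul φ } 1
    fun x => by
      rw [one_mul]
      exact (norm_map_starAut φ x).le

/-- The pair (x, 0) lies in the graph of the generator, and the group law transports the zero
derivative from time 0 to every time. Only the defining properties of the evolution enter, so the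
result holds for every α satisfying them and not just for the limit flow. -/
theorem IsTimeEvolution.apply_eq_of_d_eq_zero {α : ℝ → (CAR ≃⋆ₐ[ℂ] CAR)} (hα : IsTimeEvolution α)
    {x : CAR} (hx : x ∈ localElements) (hd : d x = 0) (t : ℝ) : α t x = x := by
  have h0 : HasDerivAt (fun s : ℝ => α s x) 0 0 := by
    have hmem : (x, (0 : CAR)) ∈ {p : CAR × CAR | HasDerivAt (fun t : ℝ => α t p.1) p.2 0} := by
      rw [hα.generator]
      exact subset_closure ⟨hx, by rw [hd, smul_zero]⟩
    exact hmem
  have ht : ∀ t, HasDerivAt (fun s : ℝ => α s x) 0 t := by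
    intro t
    have h1 : HasDerivAt (fun s : ℝ => α (s - t) x) 0 t := by
      have : HasDerivAt (fun s : ℝ => α s x) 0 (t - t) := by rwa [sub_self]
      exact this.comp_sub_const t t
    have h2 := ((starAutClm (α t)).restrictScalars ℝ).hasFDerivAt.comp_hasDerivAt t h1
    rw [map_zero] at h2
    refine h2.congr_of_eventuallyEq (Filter.Eventually.of_forall fun s => ?_)
    change _ = α t (α (s - t) x)
    rw [← hα.add, add_sub_cancel]
  have hc := is_const_of_deriv_eq_zero (fun s => (ht s).differentiableAt)
    (fun s => (ht s).deriv) t 0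
  rwa [hα.zero] at hc

theorem IsTimeEvolution.apply_monomialQ {α : ℝ → (CAR ≃⋆ₐ[ℂ] CAR)} (hα : IsTimeEvolution α)
    {k l : ℤ} {f : ℤ → ℤˣ} (h : IsConservation k l f) (t : ℝ) :
    α t (monomialQ k l f) = monomialQ k l f :=
  hα.apply_eq_of_d_eq_zero (Set.mem_iUnion.2 ⟨_, monomialQ_mem_localAlgebra k l f⟩) h.d_eq_zero t

theorem IsTimeEvolution.apply_of_mem_constantsOfMotion {α : ℝ → (CAR ≃⋆ₐ[ℂ] CAR)}
    (hα : IsTimeEvolution α) {x : CAR} (hx : x ∈ constantsOfMotion) (t : ℝ) : α t x = x := by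
  unfold constantsOfMotion at hx
  induction hx using StarAlgebra.adjoin_induction with
  | mem x hx =>
    obtain ⟨k, l, f, h, rfl⟩ := hx
    exact hα.apply_monomialQ h t
  | algebraMap z => rw [Algebra.algebraMap_eq_smul_one, map_smul, map_one]
  | add x y _ _ hx hy => rw [map_add, hx, hy]
  | mul x y _ _ hx hy => rw [map_mul, hx, hy]
  | star x _ hx => rw [map_star, hx]

end

end Nicolai

theorem theorem1 :
    (∃ α : ℝ → (Nicolai.CAR ≃⋆ₐ[ℂ] Nicolai.CAR), Nicolai.IsTimeEvolution α) ∧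
    ∀ α : ℝ → (Nicolai.CAR ≃⋆ₐ[ℂ] Nicolai.CAR), Nicolai.IsTimeEvolution α →
      (∀ B ∈ Nicolai.constantsOfMotion, ∀ t : ℝ, α t B = B) ∧
      ∀ (k l : ℤ) (f : ℤ → ℤˣ), Nicolai.IsConservation k l f → ∀ t : ℝ,
        α t (Nicolai.monomialQ k l f) = Nicolai.monomialQ k l f ∧
        α t (star (Nicolai.monomialQ k l f)) = star (Nicolai.monomialQ k l f) := by
  refine ⟨Nicolai.exists_isTimeEvolution, fun α hα =>
    ⟨fun B hB t => hα.apply_of_mem_constantsOfMotion hB t, fun k l f hf t => ?_⟩⟩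
  have h := hα.apply_monomialQ hf t
  exact ⟨h, by rw [map_star, h]⟩
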